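/- Let $n\ge 0$ be an integer, $K=U(n)$ and $K^3=K\times K\times K$, with $K$ embedded diagonally in $K^3$ by $k\mapsto(k,k,k)$. Take the maximal torus of $K^3$ consisting of triples of diagonal matrices and the positive roots $\varepsilon_j-\varepsilon_k$ ($j<k$) in each factor; let $W=S_n^3$ be the Weyl group and $w_0$ its longest element. Representations are continuous, complex and finite dimensional. For irreducible representations $\alpha,\beta$ of $K^3$ with highest weights $\lambda,\mu$, the Cartan component of $\alpha\otimes\beta$ is its irreducible subrepresentation with highest weight $\lambda+\mu$, and the PRV component of $\alpha\otimes\beta$ is its irreducible subrepresentation with extremal weight $\lambda+w_0\mu$, that is, whose highest weight is $W$-conjugate to $\lambda+w_0\mu$ (each of the two occurs with multiplicity one in $\alpha\otimes\beta$). **Proposition.** Let $\sigma_1,\sigma_2$ be irreducible representations of $K^3$ and let $\sigma_3\subset\sigma_1\otimes\sigma_2$ be the Cartan component of $\sigma_1\otimes\sigma_2$. Assume that $\dim(\sigma_i)^K=1$ for $1\le i\le 3$. Let $\phi_1$ be a nonzero $K$-invariant linear functional on the contragredient $\sigma_1^\vee$, and let $\phi_3$ be a nonzero $K$-invariant linear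 functional on $\sigma_3$. Then $\sigma_1^\vee\otimes\sigma_3$ has exactly one PRV component, this subrepresentation is isomorphic to $\sigma_2$, and the linear functional $\phi_1\otimes\phi_3$ on $\sigma_1^\vee\otimes\sigma_3$ does not vanish identically on it. -/

import Mathlib

open scoped TensorProduct

namespace PRV

/-- The compact group `K = U(n)`. -/
abbrev K (n : ℕ) := Matrix.unitaryGroup (Fin n) ℂ

/-- The compact group `K³ = K × K × K`. -/
abbrev K3 (n : ℕ) := Fin 3 → K n

/-- The diagonal embedding `K → K³`, `k ↦ (k, k, k)`. -/
def diag (n : ℕ) : K n →* K3 n where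
  toFun k := fun _ => k
  map_one' := rfl
  map_mul' _ _ := rfl

/-- The element of the maximal torus of `K³` (triples of diagonal unitary matrices) with
diagonal entries `t i j`. -/
def torusElt {n : ℕ} (t : Fin 3 → Fin n → Circle) : K3 n := fun i =>
  ⟨Matrix.diagonal fun j => (t i j : ℂ), by
    rw [Matrix.mem_unitaryGroup_iff, Matrix.star_eq_conjTranspose,
      Matrix.diagonal_conjTranspose, Matrix.diagonal_mul_diagonal, ← Matrix.diagonal_one]
    congr 1
    funext j
    simp [Complex.mul_conj]⟩

/-- Integral weights of the maximal torus of `K³`. -/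
abbrev Weight (n : ℕ) := Fin 3 → Fin n → ℤ

/-- The character `t ↦ ∏ t_{ij} ^ λ_{ij}` of the maximal torus attached to a weight. -/
noncomputable def Weight.character {n : ℕ} (lam : Weight n) (t : Fin 3 → Fin n → Circle) : ℂ :=
  ∏ i, ∏ j, (t i j : ℂ) ^ lam i j

/-- The positive roots `ε_j - ε_k` (`j < k`), in each of the three factors; they correspond
to the upper triangular Borel subgroup. -/
def posRoots (n : ℕ) : Set (Weight n) :=
  {α | ∃ (i : Fin 3) (j k : Fin n), j < k ∧ α = Pi.single i (Pi.single j 1 - Pi.single k 1)}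

/-- The Weyl group `S_n × S_n × S_n` of `K³`. -/
abbrev WeylGroup (n : ℕ) := Fin 3 → Equiv.Perm (Fin n)

/-- The action of the Weyl group on weights by permutation of the coordinates. -/
def WeylGroup.act {n : ℕ} (w : WeylGroup n) (lam : Weight n) : Weight n :=
  fun i j => lam i ((w i)⁻¹ j)

/-- The longest element of the Weyl group. -/
def w₀ (n : ℕ) : WeylGroup n := fun _ => Fin.revPerm

section Representations

variable {n : ℕ} {V W : Type*} [AddCommGroup V] [Module ℂ V] [AddCommGroup W] [Module ℂ W]

/-- Continuity of a (finite dimensional) representation of `K³`: all matrix coefficients are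
continuous functions on `K³`. -/
def IsContinuousRep (ρ : Representation ℂ (K3 n) V) : Prop :=
  ∀ (v : V) (f : Module.Dual ℂ V), Continuous fun g : K3 n => f (ρ g v)

/-- The space of vectors of weight `lam` for the maximal torus. -/
def weightSpace (ρ : Representation ℂ (K3 n) V) (lam : Weight n) : Submodule ℂ V where
  carrier := {v | ∀ t, ρ (torusElt t) v = lam.character t • v}
  add_mem' ha hb t := by rw [map_add, ha t, hb t, smul_add]
  zero_mem' t := by simp
  smul_mem' c v hv t := by rw [map_smul, hv t, smul_comm]

/-- `lam` is the highest weight of `ρ`: it is a weight, and every weight `mu` of `ρ` is obtained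
from it by subtracting a sum of positive roots. -/
def HasHighestWeight (ρ : Representation ℂ (K3 n) V) (lam : Weight n) : Prop :=
  weightSpace ρ lam ≠ ⊥ ∧
    ∀ mu : Weight n, weightSpace ρ mu ≠ ⊥ → lam - mu ∈ AddSubmonoid.closure (posRoots n)

/-- `mu` is an extremal weight of `ρ`: it lies in the Weyl group orbit of the highest weight. -/
def HasExtremalWeight (ρ : Representation ℂ (K3 n) V) (mu : Weight n) : Prop :=
  ∃ (lam : Weight n) (w : WeylGroup n), HasHighestWeight ρ lam ∧ mu = w.act lam

/-- The space of `K`-fixed vectors of a representation of `K³`, where `K` is embedded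
diagonally. -/
noncomputable def invariantsK (ρ : Representation ℂ (K3 n) V) : Submodule ℂ V :=
  Representation.invariants (ρ.comp (diag n))

/-- A linear functional that is invariant under the diagonal subgroup `K` of `K³`. -/
def IsKInvariant (ρ : Representation ℂ (K3 n) V) (φ : Module.Dual ℂ V) : Prop :=
  ∀ (k : K n) (v : V), φ (ρ (diag n k) v) = φ v

/-- `C` is the Cartan component of `ρ ⊗ ρ'` (for irreducible `ρ`, `ρ'` with highest weights
`lam`, `mu`): the irreducible constituent with highest weight `lam + mu`. -/
def IsCartanComponent (ρ : Representation ℂ (K3 n) V) (ρ' : Representation ℂ (K3 n) W)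
    (C : Subrepresentation (ρ.tprod ρ')) : Prop :=
  C.toRepresentation.IsIrreducible ∧
    ∃ lam mu : Weight n, HasHighestWeight ρ lam ∧ HasHighestWeight ρ' mu ∧
      HasHighestWeight C.toRepresentation (lam + mu)

/-- `P` is the PRV component of `ρ ⊗ ρ'` (for irreducible `ρ`, `ρ'` with highest weights
`lam`, `mu`): the irreducible constituent with extremal weight `lam + w₀ mu`. -/
def IsPRVComponent (ρ : Representation ℂ (K3 n) V) (ρ' : Representation ℂ (K3 n) W)
    (P : Subrepresentation (ρ.tprod ρ')) : Prop :=
  P.toRepresentation.IsIrreducible ∧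
    ∃ lam mu : Weight n, HasHighestWeight ρ lam ∧ HasHighestWeight ρ' mu ∧
      HasExtremalWeight P.toRepresentation (lam + (w₀ n).act mu)

end Representations

end PRV

/-! Let `p` be the equivariant projection of `σ₁ ⊗ σ₂` onto its Cartan component. Dualising the
first factor turns `p` into an equivariant map `j : V₂ → V₁* ⊗ σ₃`. Since `φ₁` is evaluation at a
`K`-fixed vector `u₁`, a `K`-fixed `u₂` in `V₂` satisfies `(φ₁ ⊗ φ₃)(j u₂) = φ₃ (p (u₁ ⊗ u₂))`. Once
this number is nonzero, `j` is injective, its image is a copy of `σ₂`, and `φ₁ ⊗ φ₃` does not vanish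
there.

The key point is `cartan_projection_tmul_ne_zero`: `p` kills no nonzero pure tensor. A highest
weight covector of `σ₃` pulls back along `p` to a multiple of `ξ₁ ⊗ ξ₂`, because the top weight
space of the tensor product is a line. If `p (u₁ ⊗ u₂) = 0`, the product of the coefficients `ξ₁ (k
u₁)` and `ξ₂ (k u₂)` vanishes on `K³`. Regular functions on `K³` form an integral domain, so one
factor vanishes, contradicting irreducibility. Thus `p (u₁ ⊗ u₂)` is a nonzero invariant, and `φ₃`
detects it because the invariants of `σ₃` form a line.

For uniqueness, `-w₀λ + w₀(λ + μ) = w₀μ`, so a PRV component has highest weight `μ` and is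
isomorphic to `σ₂`. By adjunction its embedding comes from an equivariant map `σ₁ ⊗ σ₂ → σ₃`, which
must be a multiple of `p`.

The needed highest weight theory is obtained through analytic continuation. Continuous
representations extend to `GL_n(ℂ)³` with regular coefficients (`exists_complexification`), and
conjugation by a one-parameter torus contracts triangular matrices to their diagonals. This
determines highest weight coefficients on products of lower and upper triangular matrices, hence on
positive definite ones, and by continuation on `K³` (`highestWeight_coefficient`). -/

namespace PRV

/-! ### Invariant integration and weak integrals of vector-valued functions. -/

section Haar

open MeasureTheory

/-- Normalised invariant integration on a compact group. -/
theorem exists_haarFunctional (G : Type*) [Group G] [TopologicalSpace G] [IsTopologicalGroup G]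
    [CompactSpace G] :
    ∃ I : C(G, ℂ) →L[ℂ] ℂ, I 1 = 1 ∧
      (∀ (h : G) (f f' : C(G, ℂ)), (∀ x, f' x = f (h * x)) → I f' = I f) ∧
      ∀ f : C(G, ℂ), I (star f * f) = 0 → f = 0 := by
  let _ : MeasurableSpace G := borel G
  have : BorelSpace G := ⟨rfl⟩
  let μ : Measure G := Measure.haarMeasure ⊤
  have : IsProbabilityMeasure μ := ⟨by
    simpa using Measure.haarMeasure_self (K₀ := (⊤ : TopologicalSpace.PositiveCompacts G))⟩
  have hint : ∀ f : C(G, ℂ), Integrable f μ := fun f =>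
    f.continuous.integrable_of_hasCompactSupport (HasCompactSupport.of_compactSpace f)
  let I₀ : C(G, ℂ) →ₗ[ℂ] ℂ :=
    { toFun := fun f => ∫ x, f x ∂μ
      map_add' := fun f g => integral_add (hint f) (hint g)
      map_smul' := fun c f => integral_const_mul c _ }
  refine ⟨I₀.mkContinuous 1 fun f => ?_, ?_, ?_, ?_⟩
  · have := norm_integral_le_of_norm_le_const (μ := μ) (f := f) (C := ‖f‖)
      (Filter.Eventually.of_forall fun x => f.norm_coe_le_norm x)
    simpa [I₀] using this
  · simp [I₀]
  · intro h f f' hf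
    simp only [LinearMap.mkContinuous_apply]
    change ∫ x, f' x ∂μ = ∫ x, f x ∂μ
    simp_rw [hf]
    exact integral_mul_left_eq_self (fun x => f x) h
  · intro f hf
    simp only [LinearMap.mkContinuous_apply] at hf
    change ∫ x, star (f x) * f x ∂μ = 0 at hf
    have h1 : ∀ x, star (f x) * f x = ((‖f x‖ ^ 2 : ℝ) : ℂ) := fun x => by
      have := Complex.conj_mul' (f x)
      simpa using this
    simp_rw [h1] at hf
    rw [integral_complex_ofReal] at hf
    have h2 : ∫ x, ‖f x‖ ^ 2 ∂μ = 0 := by exact_mod_cast hf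
    have hc : Continuous fun x => ‖f x‖ ^ 2 := by fun_prop
    by_contra hne
    obtain ⟨x, hx⟩ : ∃ x, f x ≠ 0 := by
      by_contra hall
      push Not at hall
      exact hne (ContinuousMap.ext hall)
    exact (hc.integral_pos_of_hasCompactSupport_nonneg_nonzero (μ := μ) (x := x)
      (HasCompactSupport.of_compactSpace _) (fun x => by positivity) (by simpa using hx)).ne' h2

variable {G : Type*} [Group G] [TopologicalSpace G] [IsTopologicalGroup G] [CompactSpace G]

variable (G) in
/-- The normalised invariant integral. -/
noncomputable def haarInt : C(G, ℂ) →L[ℂ] ℂ := (exists_haarFunctional G).choose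

theorem haarInt_one : haarInt G 1 = 1 := (exists_haarFunctional G).choose_spec.1

theorem haarInt_translate (h : G) (f f' : C(G, ℂ)) (hf : ∀ x, f' x = f (h * x)) :
    haarInt G f' = haarInt G f := (exists_haarFunctional G).choose_spec.2.1 h f f' hf

theorem eq_zero_of_haarInt_star_mul_self (f : C(G, ℂ)) (hf : haarInt G (star f * f) = 0) :
    f = 0 := (exists_haarFunctional G).choose_spec.2.2 f hf

variable {V : Type*} [AddCommGroup V] [Module ℂ V] [FiniteDimensional ℂ V]

/-- The integral of a weakly continuous vector valued function. -/
noncomputable def vecInt (F : G → V) (hF : ∀ l : Module.Dual ℂ V, Continuous fun g => l (F g)) :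
    V :=
  (Module.evalEquiv ℂ V).symm
    { toFun := fun l => haarInt G ⟨fun g => l (F g), hF l⟩
      map_add' := fun l l' => by
        rw [← map_add]
        congr 1
      map_smul' := fun c l => by
        rw [RingHom.id_apply, ← map_smul]
        congr 1 }

theorem apply_vecInt (F : G → V) (hF : ∀ l : Module.Dual ℂ V, Continuous fun g => l (F g))
    (l : Module.Dual ℂ V) : l (vecInt F hF) = haarInt G ⟨fun g => l (F g), hF l⟩ := by
  rw [vecInt, Module.apply_evalEquiv_symm_apply]
  rfl

end Haar

/-! ### Compactness of the unitary group. -/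

section Compact

theorem isCompact_unitaryGroup (n : ℕ) :
    IsCompact (Matrix.unitaryGroup (Fin n) ℂ : Set (Matrix (Fin n) (Fin n) ℂ)) := by
  have h1 : IsCompact (Set.univ.pi fun _ : Fin n => Set.univ.pi fun _ : Fin n =>
      Metric.closedBall (0 : ℂ) 1) :=
    isCompact_univ_pi fun _ => isCompact_univ_pi fun _ => isCompact_closedBall _ _
  refine h1.of_isClosed_subset ?_ ?_
  · have : (Matrix.unitaryGroup (Fin n) ℂ : Set (Matrix (Fin n) (Fin n) ℂ)) =
        {A | A * star A = 1} := by
      ext A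
      exact Matrix.mem_unitaryGroup_iff
    rw [this]
    exact isClosed_eq (by fun_prop) continuous_const
  · intro A hA i _ j _
    simpa using entry_norm_bound_of_unitary hA i j

instance (n : ℕ) : CompactSpace (K n) := isCompact_iff_compactSpace.mp (isCompact_unitaryGroup n)


end Compact

/-! ### Regular functions on the complexification and their density on `K³`. -/

section Regular

/-- The complexification `GL_n(ℂ)³` of `K³`. -/
abbrev GL3 (n : ℕ) := Fin 3 → (Matrix (Fin n) (Fin n) ℂ)ˣ

/-- The inclusion of `K³` in its complexification. -/
def toGL3 (n : ℕ) : K3 n →* GL3 n where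
  toFun k := fun i => Unitary.toUnits (k i)
  map_one' := by ext1; simp
  map_mul' _ _ := by ext1; simp

@[simp] theorem toGL3_val {n : ℕ} (k : K3 n) (i : Fin 3) :
    (toGL3 n k i : Matrix (Fin n) (Fin n) ℂ) = k i := rfl

@[simp] theorem toGL3_inv_val {n : ℕ} (k : K3 n) (i : Fin 3) :
    ((toGL3 n k i)⁻¹ : (Matrix (Fin n) (Fin n) ℂ)ˣ).val = star (k i : Matrix (Fin n) (Fin n) ℂ) :=
  rfl

/-- Matrix entries and entries of the inverse matrices, as functions on `GL_n(ℂ)³`. -/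
def coordFunctions (n : ℕ) : Set (GL3 n → ℂ) :=
  {f | ∃ i a b, f = fun g => (g i).val a b} ∪ {f | ∃ i a b, f = fun g => (g i)⁻¹.val a b}

/-- The algebra of regular functions on `GL_n(ℂ)³`. -/
def regular (n : ℕ) : Subalgebra ℂ (GL3 n → ℂ) := Algebra.adjoin ℂ (coordFunctions n)

variable {n : ℕ}

theorem coord_mem_regular (i : Fin 3) (a b : Fin n) :
    (fun g : GL3 n => (g i).val a b) ∈ regular n :=
  Algebra.subset_adjoin (Or.inl ⟨i, a, b, rfl⟩)

theorem coord_inv_mem_regular (i : Fin 3) (a b : Fin n) :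
    (fun g : GL3 n => (g i)⁻¹.val a b) ∈ regular n :=
  Algebra.subset_adjoin (Or.inr ⟨i, a, b, rfl⟩)

/-- To pull back regular functions into a given algebra it suffices to pull back coordinates. -/
theorem regular_pullback {X : Type*} (S : Subalgebra ℂ (X → ℂ)) (φ : X → GL3 n)
    (h : ∀ i a b, (fun x => (φ x i).val a b) ∈ S)
    (h' : ∀ i a b, (fun x => (φ x i)⁻¹.val a b) ∈ S)
    {F : GL3 n → ℂ} (hF : F ∈ regular n) : (fun x => F (φ x)) ∈ S := by
  induction hF using Algebra.adjoin_induction with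
  | mem f hf =>
    rcases hf with ⟨i, a, b, rfl⟩ | ⟨i, a, b, rfl⟩
    · exact h i a b
    · exact h' i a b
  | algebraMap r => exact S.algebraMap_mem r
  | add f g _ _ hf hg => exact S.add_mem hf hg
  | mul f g _ _ hf hg => exact S.mul_mem hf hg

theorem sum_fun_mem {X ι : Type*} (S : Subalgebra ℂ (X → ℂ)) (s : Finset ι) (f : ι → X → ℂ)
    (h : ∀ c ∈ s, f c ∈ S) : (fun x => ∑ c ∈ s, f c x) ∈ S := by
  have := S.sum_mem h
  convert this using 1
  ext x
  simp

theorem regular_mul_left (g₀ : GL3 n) {F : GL3 n → ℂ} (hF : F ∈ regular n) :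
    (fun g => F (g₀ * g)) ∈ regular n := by
  refine regular_pullback (regular n) (fun g => g₀ * g) (fun i a b => ?_) (fun i a b => ?_) hF
  · simp only [Pi.mul_apply, Units.val_mul, Matrix.mul_apply]
    exact sum_fun_mem _ _ _ fun c _ =>
      (regular n).smul_mem (coord_mem_regular i c b) ((g₀ i).val a c)
  · simp only [Pi.mul_apply, mul_inv_rev, Units.val_mul, Matrix.mul_apply]
    refine sum_fun_mem _ _ _ fun c _ => ?_
    simp_rw [mul_comm]
    exact (regular n).smul_mem (coord_inv_mem_regular i a c) _

theorem regular_mul_right (g₀ : GL3 n) {F : GL3 n → ℂ} (hF : F ∈ regular n) :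
    (fun g => F (g * g₀)) ∈ regular n := by
  refine regular_pullback (regular n) (fun g => g * g₀) (fun i a b => ?_) (fun i a b => ?_) hF
  · simp only [Pi.mul_apply, Units.val_mul, Matrix.mul_apply]
    refine sum_fun_mem _ _ _ fun c _ => ?_
    simp_rw [mul_comm]
    exact (regular n).smul_mem (coord_mem_regular i a c) _
  · simp only [Pi.mul_apply, mul_inv_rev, Units.val_mul, Matrix.mul_apply]
    exact sum_fun_mem _ _ _ fun c _ =>
      (regular n).smul_mem (coord_inv_mem_regular i c b) ((g₀ i)⁻¹.val a c)

/-- Functions on `X × X` that are sums of products `b x * c y` with `b, c` in a given algebra. -/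
def splitFunctions {X : Type*} (S : Subalgebra ℂ (X → ℂ)) : Subalgebra ℂ (X × X → ℂ) :=
  (Submodule.span ℂ {f : X × X → ℂ | ∃ b ∈ S, ∃ c ∈ S, f = fun p => b p.1 * c p.2}).toSubalgebra
    (Submodule.subset_span ⟨1, S.one_mem, 1, S.one_mem, by ext; simp⟩) (by
      intro f g hf hg
      have := Submodule.mul_mem_mul hf hg
      rw [Submodule.span_mul_span] at this
      refine Submodule.span_mono ?_ this
      rintro _ ⟨_, ⟨b, hb, c, hc, rfl⟩, _, ⟨b', hb', c', hc', rfl⟩, rfl⟩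
      refine ⟨b * b', S.mul_mem hb hb', c * c', S.mul_mem hc hc', ?_⟩
      ext p
      simp only [Pi.mul_apply]
      ring)

/-- Separating the variables means that integrating over the second one leaves a regular function of
the first; this is what makes the extension of a representation regular. -/
theorem regular_inv_mul {F : GL3 n → ℂ} (hF : F ∈ regular n) :
    (fun p : GL3 n × GL3 n => F (p.1⁻¹ * p.2)) ∈ splitFunctions (regular n) := by
  refine regular_pullback _ (fun p : GL3 n × GL3 n => p.1⁻¹ * p.2) (fun i a b => ?_)
    (fun i a b => ?_) hF
  · simp only [Pi.mul_apply, Pi.inv_apply, Units.val_mul, Matrix.mul_apply]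
    exact sum_fun_mem _ _ _ fun c _ => Submodule.subset_span
      ⟨_, coord_inv_mem_regular i a c, _, coord_mem_regular i c b, rfl⟩
  · simp only [Pi.mul_apply, Pi.inv_apply, mul_inv_rev, inv_inv, Units.val_mul, Matrix.mul_apply]
    refine sum_fun_mem _ _ _ fun c _ => Submodule.subset_span
      ⟨_, coord_mem_regular i c b, _, coord_inv_mem_regular i a c, ?_⟩
    ext p
    ring

theorem continuous_coord (i : Fin 3) (a b : Fin n) :
    Continuous fun k : K3 n => (k i : Matrix (Fin n) (Fin n) ℂ) a b :=
  (continuous_subtype_val.comp (continuous_apply i)).matrix_elem a b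

theorem continuous_regular_toGL3 {F : GL3 n → ℂ} (hF : F ∈ regular n) :
    Continuous fun k : K3 n => F (toGL3 n k) := by
  refine regular_pullback (continuousSubalgebra (R := ℂ) (α := K3 n) (A := ℂ)) (toGL3 n)
    (fun i a b => ?_) (fun i a b => ?_) hF
  · exact continuous_coord i a b
  · exact continuous_star.comp (continuous_coord i b a)

variable (n) in
/-- Restriction of regular functions to `K³`. -/
def restrictK3 : regular n →ₐ[ℂ] C(K3 n, ℂ) where
  toFun F := ⟨fun k => F.1 (toGL3 n k), continuous_regular_toGL3 F.2⟩
  map_one' := rfl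
  map_mul' _ _ := rfl
  map_zero' := rfl
  map_add' _ _ := rfl
  commutes' _ := rfl

@[simp] theorem restrictK3_apply (F : regular n) (k : K3 n) :
    restrictK3 n F k = F.1 (toGL3 n k) := rfl

/-- On unitary matrices the inverse is the conjugate transpose, so conjugation exchanges the two
families of coordinates. This supplies the star-closedness needed for Stone–Weierstrass. -/
theorem exists_regular_star {F : GL3 n → ℂ} (hF : F ∈ regular n) :
    ∃ F' ∈ regular n, ∀ k : K3 n, F' (toGL3 n k) = star (F (toGL3 n k)) := by
  induction hF using Algebra.adjoin_induction with
  | mem f hf =>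
    rcases hf with ⟨i, a, b, rfl⟩ | ⟨i, a, b, rfl⟩
    · exact ⟨_, coord_inv_mem_regular i b a, fun k => rfl⟩
    · exact ⟨_, coord_mem_regular i b a, fun k => (star_star _).symm⟩
  | algebraMap r => exact ⟨_, (regular n).algebraMap_mem (star r), fun k => rfl⟩
  | add f g _ _ hf hg =>
    obtain ⟨f', hf', hf''⟩ := hf
    obtain ⟨g', hg', hg''⟩ := hg
    exact ⟨_, (regular n).add_mem hf' hg', fun k => by simp [hf'', hg'']⟩
  | mul f g _ _ hf hg =>
    obtain ⟨f', hf', hf''⟩ := hf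
    obtain ⟨g', hg', hg''⟩ := hg
    exact ⟨_, (regular n).mul_mem hf' hg', fun k => by simp [hf'', hg'']⟩

/-- Regular functions are dense in the continuous functions on `K³`. -/
theorem dense_range_restrictK3 (f : C(K3 n, ℂ)) :
    f ∈ closure (Set.range (restrictK3 n)) := by
  let A : StarSubalgebra ℂ C(K3 n, ℂ) :=
    { (restrictK3 n).range with
      star_mem' := by
        rintro _ ⟨F, rfl⟩
        obtain ⟨F', hF', h⟩ := exists_regular_star F.2
        exact ⟨⟨F', hF'⟩, ContinuousMap.ext h⟩ }
  have hA : A.SeparatesPoints := by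
    intro k k' hk
    by_contra hne
    push Not at hne
    refine hk (funext fun i => Subtype.ext (Matrix.ext fun a b => ?_))
    exact hne _ ⟨_, ⟨⟨_, coord_mem_regular i a b⟩, rfl⟩, rfl⟩
  have := ContinuousMap.starSubalgebra_topologicalClosure_eq_top_of_separatesPoints A hA
  have hf : f ∈ A.topologicalClosure := by rw [this]; trivial
  exact hf

end Regular

/-! ### Regular extension of matrix coefficients. -/

section Coefficients

variable {n : ℕ} {V : Type*} [AddCommGroup V] [Module ℂ V] [FiniteDimensional ℂ V]

theorem IsContinuousRep.continuous_dual_end {ρ : Representation ℂ (K3 n) V}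
    (hρ : IsContinuousRep ρ) (L : Module.Dual ℂ (Module.End ℂ V)) :
    Continuous fun k => L (ρ k) := by
  let b := Module.finBasis ℂ V
  have h : ∀ T : Module.End ℂ V, L T = ∑ i, ∑ j, b.coord i (T (b j)) *
      L (Matrix.toLin b b (Matrix.single i j 1)) := by
    intro T
    conv_lhs => rw [← Matrix.toLin_toMatrix b b T, Matrix.matrix_eq_sum_single (LinearMap.toMatrix b b T)]
    simp only [map_sum]
    refine Finset.sum_congr rfl fun i _ => Finset.sum_congr rfl fun j _ => ?_
    rw [← mul_one (LinearMap.toMatrix b b T i j), ← smul_eq_mul, ← Matrix.smul_single, map_smul,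
      map_smul, smul_eq_mul, LinearMap.toMatrix_apply]
    rfl
  rw [funext fun k => h (ρ k)]
  exact continuous_finsetSum _ fun i _ => continuous_finsetSum _ fun j _ =>
    (hρ (b j) (b.coord i)).mul continuous_const

/-- Matrix coefficients as continuous functions. -/
def coeff {ρ : Representation ℂ (K3 n) V} (hρ : IsContinuousRep ρ)
    (L : Module.Dual ℂ (Module.End ℂ V)) : C(K3 n, ℂ) :=
  ⟨fun k => L (ρ k), hρ.continuous_dual_end L⟩

/-- The identity of `V` is the integral of `ρ` against some regular function. -/
theorem exists_regular_integral_eq_one {ρ : Representation ℂ (K3 n) V} (hρ : IsContinuousRep ρ) :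
    ∃ a : regular n, ∀ L : Module.Dual ℂ (Module.End ℂ V),
      L 1 = haarInt (K3 n) (restrictK3 n a * coeff hρ L) := by
  let S : Submodule ℂ (Module.End ℂ V) :=
    { carrier := {T | ∃ a : regular n, ∀ L : Module.Dual ℂ (Module.End ℂ V),
        L T = haarInt (K3 n) (restrictK3 n a * coeff hρ L)}
      add_mem' := by
        rintro T T' ⟨a, ha⟩ ⟨a', ha'⟩
        exact ⟨a + a', fun L => by rw [map_add, ha, ha', map_add, add_mul, map_add]⟩
      zero_mem' := ⟨0, fun L => by simp⟩
      smul_mem' := by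
        rintro c T ⟨a, ha⟩
        exact ⟨c • a, fun L => by rw [map_smul, ha, map_smul, smul_mul_assoc, map_smul]⟩ }
  by_contra hne
  have h1 : (1 : Module.End ℂ V) ∉ S := hne
  -- A functional killing all integrals of `ρ` against regular functions, but not the identity, has
  -- a coefficient orthogonal to every regular function. By density it is orthogonal to its own
  -- conjugate, hence zero, contradicting its value at `1`.
  obtain ⟨L, hL1, hL⟩ := Submodule.exists_le_ker_of_notMem h1
  have h2 : ∀ f : C(K3 n, ℂ), haarInt (K3 n) (f * coeff hρ L) = 0 := by
    intro f
    have hclosed : IsClosed {f : C(K3 n, ℂ) | haarInt (K3 n) (f * coeff hρ L) = 0} :=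
      isClosed_eq (by fun_prop) continuous_const
    refine closure_minimal ?_ hclosed (dense_range_restrictK3 f)
    rintro _ ⟨a, rfl⟩
    have hF : ∀ L : Module.Dual ℂ (Module.End ℂ V),
        Continuous fun k => L (a.1 (toGL3 n k) • ρ k) := fun L => by
      simp only [map_smul]
      exact (continuous_regular_toGL3 a.2).smul (hρ.continuous_dual_end L)
    have hT : ∀ L : Module.Dual ℂ (Module.End ℂ V), L (vecInt _ hF) =
        haarInt (K3 n) (restrictK3 n a * coeff hρ L) := fun L => by
      rw [apply_vecInt]
      congr 1
      ext k
      simp [coeff]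
    have : vecInt _ hF ∈ S := ⟨a, hT⟩
    have h3 := hL this
    rwa [LinearMap.mem_ker, hT] at h3
  have h4 := eq_zero_of_haarInt_star_mul_self _ (h2 (star (coeff hρ L)))
  apply hL1
  have h5 := DFunLike.congr_fun h4 1
  simpa [coeff] using h5

/-- A continuous representation of `K³` extends to `GL_n(ℂ)³` with regular coefficients. -/
theorem exists_regular_extension {ρ : Representation ℂ (K3 n) V} (hρ : IsContinuousRep ρ) :
    ∃ R : GL3 n → Module.End ℂ V, (∀ k, R (toGL3 n k) = ρ k) ∧
      ∀ L : Module.Dual ℂ (Module.End ℂ V), (fun g => L (R g)) ∈ regular n := by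
  obtain ⟨a, ha⟩ := exists_regular_integral_eq_one hρ
  -- The extension is `R g = ∫ a(g⁻¹k) ρ(k) dk`, with `a` chosen so that `R 1 = 1`; for `g` in `K³`,
  -- translation invariance gives `R g = ρ g`.
  let tr : GL3 n → regular n := fun g => ⟨_, regular_mul_left g⁻¹ a.2⟩
  have hF : ∀ (g : GL3 n) (L : Module.Dual ℂ (Module.End ℂ V)),
      Continuous fun k => L ((tr g).1 (toGL3 n k) • ρ k) := fun g L => by
    simp only [map_smul]
    exact (continuous_regular_toGL3 (tr g).2).smul (hρ.continuous_dual_end L)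
  have hR : ∀ (g : GL3 n) (L : Module.Dual ℂ (Module.End ℂ V)), L (vecInt _ (hF g)) =
      haarInt (K3 n) (restrictK3 n (tr g) * coeff hρ L) := fun g L => by
    rw [apply_vecInt]
    congr 1
    ext k
    simp [coeff]
  refine ⟨fun g => vecInt _ (hF g), fun k => ?_, fun L => ?_⟩
  · rw [← sub_eq_zero, ← Module.forall_dual_apply_eq_zero_iff ℂ]
    intro L
    rw [map_sub, hR, sub_eq_zero]
    have h1 := ha (L ∘ₗ LinearMap.mulLeft ℂ (ρ k))
    simp only [LinearMap.comp_apply, LinearMap.mulLeft_apply, mul_one] at h1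
    rw [h1]
    refine (haarInt_translate k _ _ fun x => ?_).symm
    simp [tr, coeff]
  · simp_rw [hR]
    -- Continuity in `k` is carried along in the induction, since the integrand must be a bundled
    -- continuous function at each stage.
    have key : ∀ Φ ∈ splitFunctions (regular n), ∃ hc : ∀ g, Continuous fun k => Φ (g, toGL3 n k),
        (fun g => haarInt (K3 n) (⟨_, hc g⟩ * coeff hρ L)) ∈ regular n := by
      intro Φ hΦ
      change Φ ∈ Submodule.span ℂ _ at hΦ
      induction hΦ using Submodule.span_induction with
      | mem Φ h =>
        obtain ⟨b, hb, c, hc, rfl⟩ := h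
        refine ⟨fun g => (continuous_regular_toGL3 hc).const_mul (b g), ?_⟩
        have : (fun g => haarInt (K3 n) ((⟨fun k => b g * c (toGL3 n k),
            (continuous_regular_toGL3 hc).const_mul (b g)⟩ : C(K3 n, ℂ)) * coeff hρ L)) =
            (haarInt (K3 n) (restrictK3 n ⟨c, hc⟩ * coeff hρ L)) • b := by
          ext g
          rw [Pi.smul_apply, smul_eq_mul, mul_comm _ (b g), ← smul_eq_mul (b g), ← map_smul]
          congr 1
          ext k
          simp [mul_assoc]
        rw [this]
        exact (regular n).smul_mem hb _
      | zero => exact ⟨fun g => continuous_const, by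
          convert (regular n).zero_mem using 1
          ext g
          rw [Pi.zero_apply, ← map_zero (haarInt (K3 n))]
          congr 1
          ext k
          simp⟩
      | add x y _ _ hx hy =>
        obtain ⟨hx, hx'⟩ := hx
        obtain ⟨hy, hy'⟩ := hy
        refine ⟨fun g => (hx g).add (hy g), ?_⟩
        convert (regular n).add_mem hx' hy' using 1
        ext g
        rw [Pi.add_apply, ← map_add, ← add_mul]
        rfl
      | smul c x _ hx =>
        obtain ⟨hx, hx'⟩ := hx
        refine ⟨fun g => (hx g).const_smul c, ?_⟩
        convert (regular n).smul_mem hx' c using 1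
        ext g
        rw [Pi.smul_apply, ← map_smul, ← smul_mul_assoc]
        rfl
    exact (key _ (regular_inv_mul a.2)).2

end Coefficients

/-! ### Matrix decompositions: unitary diagonalisation, `KAK`, and lower times upper. -/

section Decompositions

open Matrix

variable {n : ℕ}

theorem infinite_circle : Infinite Circle := by
  have : Infinite (Set.Ioc (-Real.pi) Real.pi) :=
    (Set.Ioc_infinite (by linarith [Real.pi_pos])).to_subtype
  exact Infinite.of_injective _ Circle.argEquiv.symm.injective

/-- The circle is infinite while `-g` has finitely many eigenvalues. The scalar `c` makes a Cayley
transform available. -/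
theorem exists_unit_norm_isUnit_add (g : Matrix (Fin n) (Fin n) ℂ) :
    ∃ c : ℂ, c * star c = 1 ∧ IsUnit (c • (1 : Matrix (Fin n) (Fin n) ℂ) + g) := by
  have := infinite_circle
  have hinf : (Set.range fun z : Circle => (z : ℂ)).Infinite :=
    Set.infinite_range_of_injective Circle.coe_injective
  have hfin : {z : ℂ | (-g).charpoly.IsRoot z}.Finite := by
    have := Polynomial.finite_setOfPred_isRoot (Matrix.charpoly_monic (-g)).ne_zero
    exact this
  obtain ⟨_, ⟨c, rfl⟩, hc⟩ := (hinf.sdiff hfin).nonempty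
  refine ⟨c, by simp [Complex.mul_conj], ?_⟩
  rw [Matrix.isUnit_iff_isUnit_det, isUnit_iff_ne_zero]
  intro h
  apply hc
  simp only [Set.mem_ofPred_eq, Polynomial.IsRoot.def, Matrix.eval_charpoly]
  rw [← h]
  congr 1
  rw [sub_neg_eq_add, Matrix.smul_one_eq_diagonal]
  rfl

/-- The Cayley transform `H = i(c - G)(c + G)⁻¹` of a unitary matrix is Hermitian, and a unitary
diagonalising `H` also diagonalises `G`. -/
theorem exists_unitary_diagonalization (g : K n) :
    ∃ (U : K n) (θ : Fin n → ℝ), g.val =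
      U.val * diagonal (fun j => Complex.exp (θ j * Complex.I)) * star U.val := by
  obtain ⟨G, hG⟩ := g
  have hG1 : G * star G = 1 := Matrix.mem_unitaryGroup_iff.mp hG
  have hG2 : star G * G = 1 := Matrix.mem_unitaryGroup_iff'.mp hG
  obtain ⟨c, hc, u, hu⟩ := exists_unit_norm_isUnit_add G
  have hc' : star c * c = 1 := by rw [mul_comm]; exact hc
  have hc'' : (starRingEnd ℂ) c * c = 1 := hc'
  have hcomm : (c • (1 : Matrix (Fin n) (Fin n) ℂ) - G) * u = u * (c • 1 - G) := by
    rw [hu]; simp only [sub_mul, mul_add, add_mul, mul_sub]; simp; abel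
  have hstar : star u.val = star c • (star G * u) := by
    rw [hu]; simp [mul_add, smul_add, smul_smul, hc'', hG2, add_comm]
  have hstar' : star (c • (1 : Matrix (Fin n) (Fin n) ℂ) - G) =
      -(star c • (star G * (c • 1 - G))) := by
    simp [mul_sub, smul_sub, smul_smul, hc'', hG2]
  let H : Matrix (Fin n) (Fin n) ℂ := Complex.I • ((c • 1 - G) * (u⁻¹).val)
  have hHu : H * u = Complex.I • (c • 1 - G) := by simp [H, mul_assoc]
  have hH : H.IsHermitian := by
    change star H = H
    have e1 : star H = - (Complex.I • (star (u⁻¹).val * star (c • (1 : Matrix (Fin n) (Fin n) ℂ) - G))) := by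
      simp [H]
    have e2 : star (u⁻¹).val * star u.val = 1 := by
      rw [← star_mul]; simp
    have e3 : star (u⁻¹).val * (star c • star G) = (u⁻¹).val := by
      rw [hstar] at e2
      calc star (u⁻¹).val * (star c • star G)
          = star (u⁻¹).val * (star c • star G) * (u * (u⁻¹).val) := by simp
        _ = (star (u⁻¹).val * (star c • (star G * u))) * (u⁻¹).val := by
            simp only [smul_mul_assoc, mul_assoc, mul_smul_comm]
        _ = _ := by rw [e2, one_mul]
    rw [e1, hstar', mul_neg, smul_neg, neg_neg]
    have e4 : star (u⁻¹).val * (star c • (star G * (c • 1 - G))) = (u⁻¹).val * (c • 1 - G) := by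
      rw [← smul_mul_assoc, ← mul_assoc, e3]
    rw [e4]
    simp only [H]
    congr 1
    rw [Units.inv_mul_eq_iff_eq_mul, ← mul_assoc, ← hcomm]
    simp [mul_assoc]
  clear_value H
  let U := hH.eigenvectorUnitary
  let x := hH.eigenvalues
  have hU1 : U.val * star U.val = 1 :=
    Matrix.mem_unitaryGroup_iff.mp U.2
  have hU2 : star U.val * U.val = 1 := Matrix.mem_unitaryGroup_iff'.mp U.2
  have hsp : H = U.val * diagonal (fun j => (x j : ℂ)) * star U.val := by
    have := hH.spectral_theorem
    rw [Unitary.conjStarAlgAut_apply] at this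
    exact this
  let G' : Matrix (Fin n) (Fin n) ℂ := star U.val * G * U.val
  have hGG' : G = U.val * G' * star U.val := by
    simp only [G', mul_assoc, hU1, mul_one]
    rw [← mul_assoc, hU1, one_mul]
  -- This is the inverse Cayley transform `(H + i)G = c(i - H)` read in the eigenbasis of `H`; since
  -- `x j + i` is never zero, it forces `G'` to be diagonal.
  have hmain : diagonal (fun j => (x j : ℂ) + Complex.I) * G' =
      diagonal fun j => c * (Complex.I - x j) := by
    have h1 : diagonal (fun j => (x j : ℂ)) = star U.val * H * U.val := by
      rw [hsp]
      simp only [mul_assoc, hU2, mul_one]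
      rw [← mul_assoc, hU2, one_mul]
    have h2 : diagonal (fun j => (x j : ℂ) + Complex.I) =
        star U.val * (H + Complex.I • 1) * U := by
      rw [mul_add, add_mul, ← h1]
      simp only [mul_smul_comm, smul_mul_assoc, mul_one, hU2]
      simp only [smul_one_eq_diagonal, diagonal_add]
    have h3 : diagonal (fun j => c * (Complex.I - x j)) =
        star U.val * (c • (Complex.I • 1 - H)) * U := by
      rw [smul_sub, mul_sub, sub_mul, mul_smul_comm, mul_smul_comm c, smul_mul_assoc c,
        smul_mul_assoc c, ← h1]
      simp only [mul_smul_comm, smul_mul_assoc, mul_one, hU2]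
      simp only [smul_one_eq_diagonal]
      ext a b
      by_cases hab : a = b
      · subst hab; simp; ring
      · simp [hab]
    have h4 : (H + Complex.I • 1) * G = c • (Complex.I • 1 - H) := by
      have : H * (c • 1 + G) = Complex.I • (c • 1 - G) := by rw [← hu, hHu]
      rw [mul_add, mul_smul_comm, mul_one] at this
      rw [add_mul, smul_mul_assoc, one_mul, eq_sub_of_add_eq' this]
      simp only [smul_sub, smul_comm c]
      abel
    rw [h2, h3, ← h4]
    simp only [G', mul_assoc]
    rw [← mul_assoc U.val (star U.val), hU1, one_mul]
  have hne : ∀ j, (x j : ℂ) + Complex.I ≠ 0 := fun j h => by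
    have := congrArg Complex.im h
    simp at this
  have hdiag : G' = diagonal fun j => c * (Complex.I - x j) / (x j + Complex.I) := by
    ext a b
    have := congrFun (congrFun hmain a) b
    rw [diagonal_mul] at this
    by_cases hab : a = b
    · subst hab
      rw [diagonal_apply_eq] at this ⊢
      rw [eq_div_iff (hne a), mul_comm, this]
    · rw [diagonal_apply_ne _ hab] at this ⊢
      exact (mul_eq_zero.mp this).resolve_left (hne a)
  have hcn : ‖c‖ = 1 := by
    have h := congrArg norm hc
    rw [norm_mul, norm_star, norm_one] at h
    nlinarith [norm_nonneg c]
  have hnorm : ∀ j, ‖c * (Complex.I - x j) / (x j + Complex.I)‖ = 1 := fun j => by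
    rw [norm_div, norm_mul, hcn, one_mul, div_eq_one_iff_eq (norm_ne_zero_iff.mpr (hne j)),
      ← norm_star, ← norm_neg]
    congr 1
    simp
  refine ⟨U, fun j => (c * (Complex.I - x j) / (x j + Complex.I)).arg, ?_⟩
  have : (fun j => c * (Complex.I - x j) / (x j + Complex.I)) =
      fun j => Complex.exp ((c * (Complex.I - x j) / (x j + Complex.I)).arg * Complex.I) := by
    ext j
    have := Complex.norm_mul_exp_arg_mul_I (c * (Complex.I - x j) / (x j + Complex.I))
    rw [hnorm, Complex.ofReal_one, one_mul] at this
    exact this.symm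
  rw [← this, ← hdiag]
  exact hGG'

open scoped ComplexOrder in
/-- The Cartan decomposition `GL_n(ℂ) = U(n) A U(n)`. -/
theorem exists_cartan_decomposition (g : (Matrix (Fin n) (Fin n) ℂ)ˣ) :
    ∃ (k k' : K n) (x : Fin n → ℝ), g.val =
      k.val * diagonal (fun j => Complex.exp (x j)) * k'.val := by
  have hS : (g.valᴴ * g.val).PosDef :=
    Matrix.PosDef.conjTranspose_mul_self _
      (Matrix.mulVec_injective_iff_isUnit.mpr g.isUnit)
  let U := hS.1.eigenvectorUnitary
  let d := hS.1.eigenvalues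
  have hd : ∀ j, 0 < d j := hS.eigenvalues_pos
  have hU1 : U.val * star U.val = 1 :=
    Matrix.mem_unitaryGroup_iff.mp U.2
  have hU2 : star U.val * U.val = 1 := Matrix.mem_unitaryGroup_iff'.mp U.2
  have hsp : g.valᴴ * g.val =
      U.val * diagonal (fun j => (d j : ℂ)) * star U.val := by
    have := hS.1.spectral_theorem
    rw [Unitary.conjStarAlgAut_apply] at this
    exact this
  -- The eigenvalues `d j` of `g* g` are squares of singular values, so `exp (x j)` is a singular
  -- value and `g U exp(-x)` is unitary.
  let x : Fin n → ℝ := fun j => Real.log (d j) / 2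
  have hx : ∀ j, Complex.exp (x j) * Complex.exp (x j) = d j := fun j => by
    rw [← Complex.exp_add, ← Complex.ofReal_add, ← Complex.ofReal_exp, add_halves,
      Real.exp_log (hd j)]
  let E : Matrix (Fin n) (Fin n) ℂ := diagonal fun j => Complex.exp (-x j)
  let E' : Matrix (Fin n) (Fin n) ℂ := diagonal fun j => Complex.exp (x j)
  have hEE' : E * E' = 1 := by
    simp only [E, E', diagonal_mul_diagonal, ← Complex.exp_add, neg_add_cancel, Complex.exp_zero,
      diagonal_one]
  have hEs : star E = E := by
    simp only [E, star_eq_conjTranspose, diagonal_conjTranspose]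
    congr 1
    ext j
    simp [← Complex.exp_conj]
  have hEdE : E * diagonal (fun j => (d j : ℂ)) * E = 1 := by
    simp only [E, diagonal_mul_diagonal, ← hx]
    rw [← diagonal_one]
    congr 1
    ext j
    simp only [← Complex.exp_add]
    simp
  have hk : g.val * U.val * E ∈ Matrix.unitaryGroup (Fin n) ℂ := by
    rw [Matrix.mem_unitaryGroup_iff']
    calc star (g.val * U.val * E) * (g.val * U.val * E)
        = star E * (star U.val *
            (g.valᴴ * g.val) * U) * E := by
          simp only [star_mul, star_eq_conjTranspose, mul_assoc]
      _ = 1 := by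
          rw [hsp, hEs]
          simp only [mul_assoc, hU2, mul_one]
          rw [← mul_assoc (star U.val), hU2, one_mul, ← mul_assoc, hEdE]
  refine ⟨⟨_, hk⟩, star U, x, ?_⟩
  change _ = g.val * U.val * E * E' * star U.val
  rw [mul_assoc _ E, hEE', mul_one, mul_assoc, hU1, mul_one]

open scoped ComplexOrder in
/-- A positive definite matrix is a product of a lower and an upper triangular matrix. -/
theorem exists_lower_mul_upper (S : (Matrix (Fin n) (Fin n) ℂ)ˣ) (hS : S.val.PosDef) :
    ∃ L U : (Matrix (Fin n) (Fin n) ℂ)ˣ, S = L * U ∧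
      L.val.BlockTriangular (fun j => -(j : ℤ)) ∧ U.val.BlockTriangular (fun j => (j : ℤ)) := by
  let B : (Matrix (Fin n) (Fin n) ℂ)ˣ := unitOfInvertible (LDL.lowerInv hS)
  have hB : B.val.BlockTriangular (fun j => -(j : ℤ)) := fun i j hij =>
    LDL.lowerInv_triangular hS (by simpa using hij)
  refine ⟨B⁻¹, B * S, by simp, ?_, ?_⟩
  · rw [Matrix.coe_units_inv]
    exact Matrix.blockTriangular_inv_of_blockTriangular hB
  · have h1 : LDL.diag hS = B.val * S.val * (B.val)ᴴ := LDL.diag_eq_lowerInv_conj hS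
    have hBH : (B.val)ᴴ.BlockTriangular (fun j => (j : ℤ)) := fun i j hij => by
      rw [Matrix.conjTranspose_apply, hB (by simpa using hij), star_zero]
    have hu : IsUnit (B.val)ᴴ := (Units.isUnit B).star
    have h2 : (B * S).val = LDL.diag hS * ((B.val)ᴴ)⁻¹ := by
      rw [h1, mul_assoc, Matrix.mul_nonsing_inv _ ((Matrix.isUnit_iff_isUnit_det _).mp hu), mul_one]
      rfl
    rw [h2]
    have := hu.invertible
    exact (Matrix.blockTriangular_diagonal _).mul
      (Matrix.blockTriangular_inv_of_blockTriangular hBH)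

end Decompositions

/-! ### Exponential curves and analytic continuation. -/

section Curves

open Matrix Filter Topology

variable {n : ℕ}

/-- The diagonal element of `GL_n(ℂ)³` with entries `exp (h i j)`. -/
noncomputable def expDiag (h : Fin 3 → Fin n → ℂ) : GL3 n := fun i =>
  ⟨diagonal fun j => Complex.exp (h i j), diagonal fun j => Complex.exp (-h i j),
    by simp [diagonal_mul_diagonal, ← Complex.exp_add],
    by simp [diagonal_mul_diagonal, ← Complex.exp_add]⟩

theorem expDiag_val (h : Fin 3 → Fin n → ℂ) (i : Fin 3) :
    (expDiag h i).val = diagonal fun j => Complex.exp (h i j) := rfl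

theorem expDiag_inv_val (h : Fin 3 → Fin n → ℂ) (i : Fin 3) :
    (expDiag h i)⁻¹.val = diagonal fun j => Complex.exp (-h i j) := rfl

theorem expDiag_inv (h : Fin 3 → Fin n → ℂ) : (expDiag h)⁻¹ = expDiag (-h) := by
  ext1 i
  exact Units.ext rfl

theorem expDiag_mul_I (θ : Fin 3 → Fin n → ℝ) :
    expDiag (fun i j => θ i j * Complex.I) = toGL3 n (torusElt fun i j => Circle.exp (θ i j)) := by
  ext1 i
  refine Units.ext ?_
  rw [expDiag_val, toGL3_val]
  simp [torusElt]

theorem exists_toGL3_eq_conj (g : K3 n) : ∃ (k : K3 n) (θ : Fin 3 → Fin n → ℝ),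
    toGL3 n g = toGL3 n k * expDiag (fun i j => θ i j * Complex.I) * toGL3 n k⁻¹ := by
  choose k θ h using fun i => exists_unitary_diagonalization (g i)
  refine ⟨k, θ, funext fun i => Units.ext ?_⟩
  exact h i

theorem exists_GL3_eq_mul (g : GL3 n) : ∃ (k k' : K3 n) (x : Fin 3 → Fin n → ℝ),
    g = toGL3 n k * expDiag (fun i j => x i j) * toGL3 n k' := by
  choose k k' x h using fun i => exists_cartan_decomposition (g i)
  refine ⟨k, k', x, funext fun i => Units.ext ?_⟩
  exact h i

/-- The algebra of entire functions. -/
def entireFunctions : Subalgebra ℂ (ℂ → ℂ) where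
  carrier := {f | Differentiable ℂ f}
  mul_mem' hf hg := Differentiable.mul hf hg
  add_mem' hf hg := Differentiable.add hf hg
  algebraMap_mem' r := differentiable_const r

/-- Along such a curve the diagonal coordinates are exponentials and the others vanish. Questions
about regular functions thus reduce to the identity theorem in one variable. -/
theorem differentiable_regular_curve {F : GL3 n → ℂ} (hF : F ∈ regular n) (k k' : GL3 n)
    (h h' : Fin 3 → Fin n → ℂ) :
    Differentiable ℂ fun z : ℂ => F (k * expDiag (z • h + h') * k') := by
  refine regular_pullback entireFunctions (fun z : ℂ => expDiag (z • h + h')) (fun i a b => ?_)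
    (fun i a b => ?_) (regular_mul_left k (regular_mul_right k' hF))
  · change Differentiable ℂ _
    by_cases hab : a = b
    · subst hab
      simp only [expDiag_val, diagonal_apply_eq, Pi.add_apply, Pi.smul_apply, smul_eq_mul]
      fun_prop
    · simp only [expDiag_val, diagonal_apply_ne _ hab]
      fun_prop
  · change Differentiable ℂ _
    by_cases hab : a = b
    · subst hab
      simp only [expDiag_inv_val, diagonal_apply_eq, Pi.add_apply, Pi.smul_apply, smul_eq_mul]
      fun_prop
    · simp only [expDiag_inv_val, diagonal_apply_ne _ hab]
      fun_prop

theorem eq_zero_of_real {f : ℂ → ℂ} (hf : Differentiable ℂ f) (h : ∀ t : ℝ, f t = 0) (z : ℂ) :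
    f z = 0 := by
  have h1 : AnalyticOnNhd ℂ f Set.univ := fun z _ => hf.analyticAt z
  have h2 : Tendsto (fun t : ℝ => (t : ℂ)) (𝓝[≠] 0) (𝓝[≠] 0) := by
    refine tendsto_nhdsWithin_iff.mpr ⟨?_, ?_⟩
    · have : Tendsto (fun t : ℝ => (t : ℂ)) (𝓝 0) (𝓝 ((0 : ℝ) : ℂ)) :=
        Complex.continuous_ofReal.tendsto 0
      exact (by simpa using this : Tendsto _ _ (𝓝 (0 : ℂ))).mono_left nhdsWithin_le_nhds
    · filter_upwards [self_mem_nhdsWithin] with t ht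
      simpa using ht
  have h3 : ∃ᶠ w in 𝓝[≠] (0 : ℂ), f w = 0 :=
    h2.frequently (Eventually.of_forall h).frequently
  exact h1.eqOn_zero_of_preconnected_of_frequently_eq_zero isPreconnected_univ (Set.mem_univ _) h3
    (Set.mem_univ z)

theorem eq_zero_of_imaginary {f : ℂ → ℂ} (hf : Differentiable ℂ f)
    (h : ∀ t : ℝ, f (t * Complex.I) = 0) (z : ℂ) : f z = 0 := by
  have := eq_zero_of_real (f := fun w => f (w * Complex.I)) (by fun_prop) h (-z * Complex.I)
  simpa [mul_assoc] using this

/-- `K³` is Zariski dense in its complexification. -/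
theorem regular_eq_zero {F : GL3 n → ℂ} (hF : F ∈ regular n) (h : ∀ k, F (toGL3 n k) = 0)
    (g : GL3 n) : F g = 0 := by
  obtain ⟨k, k', x, rfl⟩ := exists_GL3_eq_mul g
  -- The curve `z ↦ k exp(z x) k'` lies in `K³` for imaginary `z` and passes through `g` at `z = 1`.
  have := eq_zero_of_imaginary
    (differentiable_regular_curve hF (toGL3 n k) (toGL3 n k') (fun i j => x i j) 0)
    (fun t => ?_) 1
  · simpa using this
  · have : (t * Complex.I : ℂ) • (fun (i : Fin 3) (j : Fin n) => (x i j : ℂ)) + 0 =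
        fun i j => ((t * x i j : ℝ) : ℂ) * Complex.I := by
      ext i j
      simp
      ring
    rw [this, expDiag_mul_I, ← map_mul, ← map_mul]
    exact h _

/-- The algebra of restrictions of regular functions to `K³` has no zero divisors. -/
theorem regular_eq_zero_or_eq_zero {F F' : GL3 n → ℂ} (hF : F ∈ regular n) (hF' : F' ∈ regular n)
    (h : ∀ k, F (toGL3 n k) * F' (toGL3 n k) = 0) :
    (∀ k, F (toGL3 n k) = 0) ∨ ∀ k, F' (toGL3 n k) = 0 := by
  by_contra! hne
  obtain ⟨⟨g, hg⟩, g', hg'⟩ := hne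
  -- Diagonalising `g⁻¹g'` joins the two points by a curve with value `g` at `z = 0` and `g'` at `z
  -- = 1`. On it two entire functions have zero product, so one is identically zero.
  obtain ⟨k, θ, hk⟩ := exists_toGL3_eq_conj (g⁻¹ * g')
  have hd := fun {F : GL3 n → ℂ} (hF : F ∈ regular n) => differentiable_regular_curve hF
    (toGL3 n (g * k)) (toGL3 n k⁻¹) (fun i j => θ i j * Complex.I) 0
  have h0 := fun z : ℂ => regular_eq_zero ((regular n).mul_mem hF hF') h
    (toGL3 n (g * k) * expDiag (z • (fun i j => θ i j * Complex.I : Fin 3 → Fin n → ℂ) + 0) * toGL3 n k⁻¹)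
  rcases AnalyticOnNhd.eq_zero_or_eq_zero_of_mul_eq_zero (U := Set.univ)
    (fun z _ => (hd hF).analyticAt z) (fun z _ => (hd hF').analyticAt z) (fun z _ => h0 z)
    isPreconnected_univ with h1 | h1
  · apply hg
    have := h1 0 (Set.mem_univ _)
    have e : expDiag (0 : Fin 3 → Fin n → ℂ) = 1 := by
      ext1 i
      refine Units.ext ?_
      simp [expDiag_val]
    simpa [e] using this
  · apply hg'
    have := h1 1 (Set.mem_univ _)
    rwa [one_smul, add_zero, map_mul, mul_assoc, mul_assoc, ← mul_assoc (toGL3 n k), ← hk, ← map_mul,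
      mul_inv_cancel_left] at this

end Curves

/-! ### Complexification of representations. -/

section Extension

variable {n : ℕ} {V : Type*} [AddCommGroup V] [Module ℂ V] [FiniteDimensional ℂ V]

/-- A continuous representation of `K³` extends to a representation of `GL_n(ℂ)³` with regular
coefficients. -/
theorem exists_complexification {ρ : Representation ℂ (K3 n) V} (hρ : IsContinuousRep ρ) :
    ∃ R : Representation ℂ (GL3 n) V, (∀ k, R (toGL3 n k) = ρ k) ∧
      ∀ (l : Module.Dual ℂ V) (v : V), (fun g => l (R g v)) ∈ regular n := by
  obtain ⟨R, hR, hreg⟩ := exists_regular_extension hρ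
  have hreg' : ∀ (l : Module.Dual ℂ V) (T T' : Module.End ℂ V) (v : V),
      (fun g => l (T (R g (T' v)))) ∈ regular n := fun l T T' v =>
    hreg (l ∘ₗ T ∘ₗ LinearMap.applyₗ (T' v))
  have hext : ∀ {T T' : Module.End ℂ V}, (∀ (l : Module.Dual ℂ V) v, l (T v) - l (T' v) = 0) →
      T = T' := by
    intro T T' h
    ext v
    rw [← sub_eq_zero, ← Module.forall_dual_apply_eq_zero_iff ℂ]
    intro l
    rw [map_sub, h]
  -- Multiplicativity spreads from `K³` by Zariski density one variable at a time: first the left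
  -- factor becomes arbitrary, then the right.
  have h1 : ∀ (g : GL3 n) (k : K3 n), R (g * toGL3 n k) = R g * R (toGL3 n k) := fun g k =>
    hext fun l v => regular_eq_zero (F := fun g => l (R (g * toGL3 n k) v) -
        l (R g (R (toGL3 n k) v)))
      ((regular n).sub_mem (regular_mul_right _ (hreg' l 1 1 v)) (hreg' l 1 (R (toGL3 n k)) v))
      (fun k' => by rw [← map_mul, hR, hR, hR, map_mul]; simp) g
  have h2 : ∀ g g' : GL3 n, R (g * g') = R g * R g' := fun g g' =>
    hext fun l v => regular_eq_zero (F := fun g' => l (R (g * g') v) - l (R g (R g' v)))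
      ((regular n).sub_mem (regular_mul_left _ (hreg' l 1 1 v)) (hreg' l (R g) 1 v))
      (fun k' => by rw [h1]; simp) g'
  refine ⟨⟨⟨R, ?_⟩, h2⟩, hR, fun l v => hreg' l 1 1 v⟩
  rw [← map_one (toGL3 n), hR, map_one]

end Extension

/-! ### The cone of positive roots is pointed. -/

section Cone

variable {n : ℕ}

/-- Pairing of a weight with a cocharacter that is the same in the three factors. -/
def Weight.pair (α : Weight n) (b : Fin n → ℤ) : ℤ := ∑ i, ∑ j, α i j * b j

theorem Weight.add_pair (α β : Weight n) (b : Fin n → ℤ) :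
    (α + β).pair b = α.pair b + β.pair b := by
  simp [pair, add_mul, Finset.sum_add_distrib]

theorem Weight.neg_pair (α : Weight n) (b : Fin n → ℤ) : (-α).pair b = -α.pair b := by
  simp [pair]

theorem Weight.pair_neg (α : Weight n) (b : Fin n → ℤ) :
    α.pair (fun j => -b j) = -α.pair b := by
  simp [pair]

/-- The root `ε_j - ε_k` pairs with the cocharacter `j ↦ j` to `j - k < 0`, and this sign persists
under nonempty sums. -/
theorem pair_neg_of_mem_cone {α : Weight n} (h : α ∈ AddSubmonoid.closure (posRoots n)) :
    α = 0 ∨ α.pair (fun j => (j : ℤ)) < 0 := by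
  induction h using AddSubmonoid.closure_induction with
  | mem α h =>
    obtain ⟨i, j, k, hjk, rfl⟩ := h
    right
    rw [Weight.pair, Finset.sum_eq_single i (fun i' _ hi' => by simp [Pi.single_eq_of_ne hi'])
      (by simp)]
    have : (j : ℤ) < k := by exact_mod_cast hjk
    simp [sub_mul, Finset.sum_sub_distrib, Pi.single_apply, this]
  | zero => exact Or.inl rfl
  | add α β _ _ hα hβ =>
    rw [Weight.add_pair]
    rcases hα with rfl | hα <;> rcases hβ with rfl | hβ
    · exact Or.inl (add_zero _)
    · exact Or.inr (by simpa [Weight.pair] using hβ)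
    · exact Or.inr (by simpa [Weight.pair] using hα)
    · exact Or.inr (by omega)

theorem eq_zero_of_add_eq_zero {α β : Weight n} (hα : α ∈ AddSubmonoid.closure (posRoots n))
    (hβ : β ∈ AddSubmonoid.closure (posRoots n)) (h : α + β = 0) : α = 0 ∧ β = 0 := by
  have h1 := Weight.add_pair α β fun j => (j : ℤ)
  rw [h] at h1
  have h0 : (0 : Weight n).pair (fun j => (j : ℤ)) = 0 := by simp [Weight.pair]
  rcases pair_neg_of_mem_cone hα with rfl | h2
  · exact ⟨rfl, by simpa using h⟩
  · rcases pair_neg_of_mem_cone hβ with rfl | h3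
    · exact ⟨by simpa using h, rfl⟩
    · omega

end Cone

/-! ### Characters of the torus and trigonometric polynomials. -/

section Characters

variable {n : ℕ}

/-- Coordinates of the maximal torus. -/
abbrev Torus (n : ℕ) := Fin 3 → Fin n → Circle

theorem torusElt_mul (t s : Torus n) : torusElt (t * s) = torusElt t * torusElt s := by
  ext1 i
  refine Subtype.ext ?_
  simp [torusElt, Matrix.diagonal_mul_diagonal]

theorem torusElt_one : torusElt (1 : Torus n) = 1 := by
  ext1 i
  refine Subtype.ext ?_
  simp [torusElt]

theorem torusElt_inv (t : Torus n) : torusElt t⁻¹ = (torusElt t)⁻¹ := by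
  rw [eq_inv_iff_mul_eq_one, ← torusElt_mul, inv_mul_cancel, torusElt_one]

/-- The character of a weight as a monoid homomorphism. -/
noncomputable def Weight.characterHom (lam : Weight n) : Torus n →* ℂ where
  toFun := lam.character
  map_one' := by simp [character]
  map_mul' t s := by simp [character, mul_zpow, Finset.prod_mul_distrib]

theorem Weight.character_mul (lam : Weight n) (t s : Torus n) :
    lam.character (t * s) = lam.character t * lam.character s := lam.characterHom.map_mul t s

theorem Weight.character_add (lam mu : Weight n) (t : Torus n) :
    (lam + mu).character t = lam.character t * mu.character t := by
  simp [character, zpow_add₀, Finset.prod_mul_distrib]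

theorem Weight.character_neg (lam : Weight n) (t : Torus n) :
    (-lam).character t = lam.character t⁻¹ := by
  simp [character]

theorem Weight.character_zero (t : Torus n) : (0 : Weight n).character t = 1 := by
  simp [character]

theorem Weight.character_exp (lam : Weight n) (θ : Fin 3 → Fin n → ℝ) :
    lam.character (fun i j => Circle.exp (θ i j)) =
      Complex.exp (∑ i, ∑ j, lam i j * (θ i j * Complex.I)) := by
  simp [character, Complex.exp_sum, Complex.exp_int_mul]

theorem Weight.character_injective :
    Function.Injective (Weight.character : Weight n → Torus n → ℂ) := by
  intro lam mu h
  ext i j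
  have key : ∀ (α : Weight n) (x : ℝ), α.character (fun i' j' => Circle.exp
      ((Pi.single i (Pi.single j x) : Fin 3 → Fin n → ℝ) i' j')) =
      Complex.exp (α i j * (x * Complex.I)) := by
    intro α x
    rw [character_exp, Finset.sum_eq_single i (fun i' _ hi' => by simp [Pi.single_eq_of_ne hi'])
      (by simp), Finset.sum_eq_single j (fun j' _ hj' => by simp [Pi.single_eq_of_ne hj'])
      (by simp)]
    simp
  have h1 := congrFun h (fun i' j' => Circle.exp
      ((Pi.single i (Pi.single j 1) : Fin 3 → Fin n → ℝ) i' j'))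
  rw [key, key] at h1
  obtain ⟨m, hm⟩ := Complex.exp_eq_exp_iff_exists_int.mp h1
  have h2 : (lam i j : ℝ) = mu i j + m * (2 * Real.pi) := by
    have := congrArg Complex.im hm
    simpa using this
  -- The test point has argument `1`, so equal characters give an integer difference in `2πℤ`;
  -- irrationality of `π` makes it zero.
  have hm0 : m = 0 := by
    by_contra hne
    refine (irrational_pi.ne_rat ((lam i j - mu i j : ℤ) / (2 * m : ℤ) : ℚ)) ?_
    have : (m : ℝ) ≠ 0 := by exact_mod_cast hne
    push_cast
    field_simp
    linarith
  rw [hm0] at h2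
  exact_mod_cast (by simpa using h2 : (lam i j : ℝ) = mu i j)

theorem linearIndependent_character :
    LinearIndependent ℂ (Weight.character : Weight n → Torus n → ℂ) := by
  have h := linearIndependent_monoidHom (Torus n) ℂ
  refine h.comp Weight.characterHom fun lam mu hlm => Weight.character_injective ?_
  exact congrArg DFunLike.coe hlm

variable (n) in
/-- The algebra of trigonometric polynomials on the torus. -/
def trigPolynomials : Subalgebra ℂ (Torus n → ℂ) :=
  (Submodule.span ℂ (Set.range (Weight.character : Weight n → Torus n → ℂ))).toSubalgebra
    (Submodule.subset_span ⟨0, funext fun t => Weight.character_zero t⟩) (by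
      intro f g hf hg
      have := Submodule.mul_mem_mul hf hg
      rw [Submodule.span_mul_span] at this
      refine Submodule.span_mono ?_ this
      rintro _ ⟨_, ⟨lam, rfl⟩, _, ⟨mu, rfl⟩, rfl⟩
      exact ⟨lam + mu, funext fun t => Weight.character_add lam mu t⟩)

theorem regular_torus {F : GL3 n → ℂ} (hF : F ∈ regular n) :
    (fun t => F (toGL3 n (torusElt t))) ∈ trigPolynomials n := by
  have key : ∀ (e : ℤ) (i : Fin 3) (a b : Fin n), (fun t : Torus n =>
      (Matrix.diagonal fun j => (t i j : ℂ) ^ e) a b) ∈ trigPolynomials n := by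
    intro e i a b
    by_cases hab : a = b
    · subst hab
      refine Submodule.subset_span ⟨Pi.single i (Pi.single a e), funext fun t => ?_⟩
      rw [Matrix.diagonal_apply_eq, Weight.character,
        Finset.prod_eq_single i (fun i' _ hi' => by simp [Pi.single_eq_of_ne hi']) (by simp),
        Finset.prod_eq_single a (fun j' _ hj' => by simp [Pi.single_eq_of_ne hj']) (by simp)]
      simp
    · simp only [Matrix.diagonal_apply_ne _ hab]
      exact (trigPolynomials n).zero_mem
  refine regular_pullback (trigPolynomials n) (fun t => toGL3 n (torusElt t)) (fun i a b => ?_)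
    (fun i a b => ?_) hF
  · simpa [torusElt] using key 1 i a b
  · have := key (-1) i a b
    have e : ∀ t : Torus n, (toGL3 n (torusElt t) i)⁻¹.val = (torusElt t⁻¹ i).val := fun t => by
      rw [torusElt_inv]
      rfl
    simp_rw [e]
    simpa [torusElt] using this

end Characters

/-! ### Weight vectors and weight covectors. -/

section WeightSpaces

variable {n : ℕ} {V : Type*} [AddCommGroup V] [Module ℂ V]

/-- `ξ` is a linear functional on which the torus acts by a character. -/
def IsWeightCovector (ρ : Representation ℂ (K3 n) V) (lam : Weight n) (ξ : Module.Dual ℂ V) :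
    Prop :=
  ∀ t v, ξ (ρ (torusElt t) v) = lam.character t * ξ v

theorem mem_weightSpace_dual_iff {ρ : Representation ℂ (K3 n) V} {lam : Weight n}
    {ξ : Module.Dual ℂ V} : ξ ∈ weightSpace ρ.dual (-lam) ↔ IsWeightCovector ρ lam ξ := by
  have h : ∀ (t : Torus n) (v : V), ρ.dual (torusElt t) ξ v = ξ (ρ (torusElt t⁻¹) v) := by
    intro t v
    rw [torusElt_inv]
    rfl
  constructor
  · intro hξ t v
    have := LinearMap.congr_fun (hξ t⁻¹) v
    rw [h, inv_inv, Weight.character_neg, inv_inv] at this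
    exact this
  · intro hξ t
    ext v
    rw [h, hξ, Weight.character_neg]
    rfl

theorem IsWeightCovector.apply_eq_zero {ρ : Representation ℂ (K3 n) V} {lam mu : Weight n}
    {ξ : Module.Dual ℂ V} (hξ : IsWeightCovector ρ lam ξ) {v : V} (hv : v ∈ weightSpace ρ mu)
    (h : lam ≠ mu) : ξ v = 0 := by
  by_contra hne
  refine h (Weight.character_injective (funext fun t => ?_))
  have := hξ t v
  rw [hv t, map_smul, smul_eq_mul] at this
  exact (mul_right_cancel₀ hne this).symm

variable [FiniteDimensional ℂ V]

theorem IsContinuousRep.dual {ρ : Representation ℂ (K3 n) V} (hρ : IsContinuousRep ρ) :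
    IsContinuousRep ρ.dual := by
  intro ξ f
  obtain ⟨v, rfl⟩ := (Module.evalEquiv ℂ V).surjective f
  exact (hρ v ξ).comp continuous_inv

/-- A continuous representation is spanned by weight vectors. -/
theorem iSup_weightSpace_eq_top {ρ : Representation ℂ (K3 n) V} (hρ : IsContinuousRep ρ) :
    ⨆ lam, weightSpace ρ lam = ⊤ := by
  rw [eq_top_iff]
  rintro v -
  obtain ⟨R, hR, hreg⟩ := exists_complexification hρ
  let Ψ : (Weight n →₀ V) →ₗ[ℂ] (Torus n → V) := Finsupp.lsum ℂ fun lam =>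
    { toFun := fun w t => lam.character t • w
      map_add' := fun w w' => funext fun t => smul_add _ _ _
      map_smul' := fun c w => funext fun t => smul_comm _ _ _ }
  have hΨ : ∀ w t, Ψ w t = ∑ lam ∈ w.support, lam.character t • w lam := by
    intro w t
    simp [Ψ, Finsupp.sum]
  have h1 : (fun t => ρ (torusElt t) v) ∈ LinearMap.range Ψ := by
    let b := Module.finBasis ℂ V
    have e1 : (fun t => ρ (torusElt t) v) =
        ∑ i, fun t : Torus n => b.coord i (ρ (torusElt t) v) • b i := by
      ext t
      rw [Finset.sum_apply]
      exact (b.sum_repr _).symm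
    rw [e1]
    refine Submodule.sum_mem _ fun i _ => ?_
    have h2 := regular_torus (hreg (b.coord i) v)
    simp_rw [hR] at h2
    change _ ∈ Submodule.span ℂ _ at h2
    have key : ∀ f ∈ Submodule.span ℂ (Set.range (Weight.character : Weight n → Torus n → ℂ)),
        (fun t => f t • b i) ∈ LinearMap.range Ψ := by
      intro f hf
      induction hf using Submodule.span_induction with
      | mem f h =>
        obtain ⟨lam, rfl⟩ := h
        exact ⟨Finsupp.single lam (b i), by simp only [Ψ, Finsupp.lsum_single]; rfl⟩
      | zero => convert (LinearMap.range Ψ).zero_mem using 1; ext t; simp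
      | add f g _ _ hf hg => convert (LinearMap.range Ψ).add_mem hf hg using 1; ext t; simp [add_smul]
      | smul c f _ hf =>
        convert (LinearMap.range Ψ).smul_mem c hf using 1; ext t; simp [smul_smul]
    exact key _ h2
  obtain ⟨w, hw⟩ := h1
  have hw' : ∀ t, ρ (torusElt t) v = ∑ lam ∈ w.support, lam.character t • w lam := fun t => by
    rw [← hΨ, hw]
  have hv := hw' 1
  rw [torusElt_one, map_one, Module.End.one_apply] at hv
  rw [hv]
  refine Submodule.sum_mem _ fun lam hlam => Submodule.smul_mem _ _
    (Submodule.mem_iSup_of_mem lam fun s => ?_)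
  rw [← sub_eq_zero, ← Module.forall_dual_apply_eq_zero_iff ℂ]
  intro l
  -- Expanding `ρ(s)ρ(t)v = ρ(st)v` in characters of `t` and comparing coefficients shows that each
  -- `w lam` is a weight vector.
  refine linearIndependent_iff'.mp linearIndependent_character w.support
    (fun lam => l (ρ (torusElt s) (w lam) - lam.character s • w lam)) ?_ lam hlam
  ext t
  have e2 : ρ (torusElt s) (ρ (torusElt t) v) = ρ (torusElt (s * t)) v := by
    rw [torusElt_mul, map_mul]
    rfl
  rw [hw', hw'] at e2
  have e3 := congrArg l e2
  simp only [map_sum, map_smul, smul_eq_mul, Weight.character_mul] at e3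
  simp only [Finset.sum_apply, Pi.smul_apply, smul_eq_mul, map_sub, map_smul, sub_mul,
    Finset.sum_sub_distrib, Pi.zero_apply]
  rw [sub_eq_zero]
  convert e3 using 2
  · ring
  · ring

/-- Two vectors on which all weight covectors agree are equal. -/
theorem eq_of_weightCovectors {ρ : Representation ℂ (K3 n) V} (hρ : IsContinuousRep ρ) {v w : V}
    (h : ∀ mu ξ, IsWeightCovector ρ mu ξ → ξ v = ξ w) : v = w := by
  rw [← sub_eq_zero, ← Module.forall_dual_apply_eq_zero_iff ℂ]
  intro ξ
  have hξ : ξ ∈ ⨆ lam, weightSpace ρ.dual lam := by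
    rw [iSup_weightSpace_eq_top hρ.dual]
    trivial
  induction hξ using Submodule.iSup_induction' with
  | mem lam ξ hξ =>
    rw [map_sub, sub_eq_zero]
    exact h (-lam) ξ (mem_weightSpace_dual_iff.mp (by rwa [neg_neg]))
  | zero => rfl
  | add ξ η _ _ hξ hη => rw [LinearMap.add_apply, hξ, hη, add_zero]

/-- Two functionals which agree on all weight vectors are equal. -/
theorem dual_eq_of_weightVectors {ρ : Representation ℂ (K3 n) V} (hρ : IsContinuousRep ρ)
    {W : Type*} [AddCommGroup W] [Module ℂ W] {ξ η : V →ₗ[ℂ] W}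
    (h : ∀ mu, ∀ v ∈ weightSpace ρ mu, ξ v = η v) : ξ = η := by
  ext v
  have hv : v ∈ ⨆ lam, weightSpace ρ lam := by
    rw [iSup_weightSpace_eq_top hρ]
    trivial
  induction hv using Submodule.iSup_induction' with
  | mem lam v hv => exact h lam v hv
  | zero => simp
  | add v w _ _ hv hw => rw [map_add, map_add, hv, hw]

theorem exists_weightCovector_apply_ne_zero {ρ : Representation ℂ (K3 n) V}
    (hρ : IsContinuousRep ρ) {lam : Weight n} {v : V} (hv : v ∈ weightSpace ρ lam) (h : v ≠ 0) :
    ∃ ξ, IsWeightCovector ρ lam ξ ∧ ξ v ≠ 0 := by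
  by_contra! hne
  refine h (eq_of_weightCovectors hρ fun mu ξ hξ => ?_)
  rw [map_zero]
  by_cases hmu : mu = lam
  · subst hmu
    exact hne ξ hξ
  · exact hξ.apply_eq_zero hv hmu

theorem IsWeightCovector.weightSpace_ne_bot {ρ : Representation ℂ (K3 n) V}
    (hρ : IsContinuousRep ρ) {lam : Weight n} {ξ : Module.Dual ℂ V}
    (hξ : IsWeightCovector ρ lam ξ) (h : ξ ≠ 0) : weightSpace ρ lam ≠ ⊥ := by
  intro hbot
  refine h (dual_eq_of_weightVectors hρ fun mu v hv => ?_)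
  by_cases hmu : lam = mu
  · subst hmu
    rw [hbot, Submodule.mem_bot] at hv
    simp [hv]
  · simpa using hξ.apply_eq_zero hv hmu

end WeightSpaces

/-! ### Action of the complex torus on weight vectors and covectors. -/

section Complexification

variable {n : ℕ} {V : Type*} [AddCommGroup V] [Module ℂ V]

/-- `R` is an extension of `ρ` to `GL_n(ℂ)³` with regular coefficients. -/
structure IsComplexification (ρ : Representation ℂ (K3 n) V) (R : Representation ℂ (GL3 n) V) :
    Prop where
  apply_toGL3 : ∀ k, R (toGL3 n k) = ρ k
  mem_regular : ∀ (l : Module.Dual ℂ V) (v : V), (fun g => l (R g v)) ∈ regular n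

/-- The character of the complex torus attached to a weight, in logarithmic coordinates. -/
noncomputable def Weight.expChar (lam : Weight n) (h : Fin 3 → Fin n → ℂ) : ℂ :=
  Complex.exp (∑ i, ∑ j, lam i j * h i j)

theorem Weight.expChar_neg (lam : Weight n) (h : Fin 3 → Fin n → ℂ) :
    lam.expChar (-h) = (lam.expChar h)⁻¹ := by
  simp [expChar, ← Complex.exp_neg]

theorem Weight.expChar_cocharacter (lam : Weight n) (b : Fin n → ℤ) (s : ℝ) :
    lam.expChar (fun _ j => (s : ℂ) * b j) = Complex.exp (s * lam.pair b) := by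
  rw [expChar, pair]
  congr 1
  push_cast
  simp only [Finset.mul_sum]
  exact Finset.sum_congr rfl fun i _ => Finset.sum_congr rfl fun j _ => by ring

namespace IsComplexification

variable {ρ : Representation ℂ (K3 n) V} {R : Representation ℂ (GL3 n) V}
  (hR : IsComplexification ρ R)

include hR

/-- The imaginary part of `x` already lies in the compact torus. Multiplying the real part by `z`
gives an entire function identity that holds for imaginary `z`, hence at `z = 1`. -/
theorem apply_expDiag_of_torus {lam : Weight n} {l : Module.Dual ℂ V} {v : V}
    (h : ∀ t, l (ρ (torusElt t) v) = lam.character t * l v) (x : Fin 3 → Fin n → ℂ) :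
    l (R (expDiag x) v) = lam.expChar x * l v := by
  let y : Fin 3 → Fin n → ℂ := fun i j => (x i j).re
  let θ : Fin 3 → Fin n → ℂ := fun i j => (x i j).im * Complex.I
  have hx : x = (1 : ℂ) • y + θ := by
    ext i j
    simp [y, θ]
  have hd : Differentiable ℂ fun z : ℂ =>
      l (R (expDiag (z • y + θ)) v) - lam.expChar (z • y + θ) * l v := by
    have h1 := differentiable_regular_curve (hR.mem_regular l v) 1 1 y θ
    simp only [one_mul, mul_one] at h1
    refine h1.sub (Differentiable.mul_const ?_ _)
    simp only [Weight.expChar, Pi.add_apply, Pi.smul_apply, smul_eq_mul]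
    fun_prop
  have h0 := eq_zero_of_imaginary hd (fun t => ?_) 1
  · rw [← hx] at h0
    exact sub_eq_zero.mp h0
  · have e : (t * Complex.I : ℂ) • y + θ =
        fun i j => ((t * (x i j).re + (x i j).im : ℝ) : ℂ) * Complex.I := by
      ext i j
      simp [y, θ]
      ring
    rw [e, expDiag_mul_I, hR.apply_toGL3, h, Weight.character_exp, Weight.expChar, sub_self]

theorem apply_expDiag {lam : Weight n} {v : V} (hv : v ∈ weightSpace ρ lam)
    (x : Fin 3 → Fin n → ℂ) : R (expDiag x) v = lam.expChar x • v := by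
  rw [← sub_eq_zero, ← Module.forall_dual_apply_eq_zero_iff ℂ]
  intro l
  rw [map_sub, map_smul, smul_eq_mul, sub_eq_zero]
  exact hR.apply_expDiag_of_torus (fun t => by rw [hv t, map_smul, smul_eq_mul]) x

theorem covector_apply_expDiag {lam : Weight n} {ξ : Module.Dual ℂ V}
    (hξ : IsWeightCovector ρ lam ξ) (x : Fin 3 → Fin n → ℂ) (v : V) :
    ξ (R (expDiag x) v) = lam.expChar x * ξ v :=
  hR.apply_expDiag_of_torus (fun t => hξ t v) x

end IsComplexification

end Complexification

/-! ### Contracting triangular matrices to their diagonals. -/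

section Contraction

open Filter Topology Matrix

variable {n : ℕ} {V : Type*} [AddCommGroup V] [Module ℂ V]

theorem tendsto_regular {ι : Type*} {f : Filter ι} {γ : ι → GL3 n} {g : GL3 n}
    (h : ∀ i a b, Tendsto (fun s => (γ s i).val a b) f (𝓝 ((g i).val a b)))
    (h' : ∀ i a b, Tendsto (fun s => (γ s i)⁻¹.val a b) f (𝓝 ((g i)⁻¹.val a b)))
    {F : GL3 n → ℂ} (hF : F ∈ regular n) : Tendsto (fun s => F (γ s)) f (𝓝 (F g)) := by
  induction hF using Algebra.adjoin_induction with
  | mem F hF =>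
    rcases hF with ⟨i, a, b, rfl⟩ | ⟨i, a, b, rfl⟩
    · exact h i a b
    · exact h' i a b
  | algebraMap r => exact tendsto_const_nhds
  | add F F' _ _ hF hF' => exact hF.add hF'
  | mul F F' _ _ hF hF' => exact hF.mul hF'

theorem blockTriangular_units_inv {b : Fin n → ℤ} {u : (Matrix (Fin n) (Fin n) ℂ)ˣ}
    (hu : u.val.BlockTriangular b) : (u⁻¹).val.BlockTriangular b := by
  have := u.isUnit.invertible
  rw [Matrix.coe_units_inv]
  exact Matrix.blockTriangular_inv_of_blockTriangular hu

theorem blockTriangular_mul_diag {b : Fin n → ℤ} (hb : Function.Injective b)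
    {A B : Matrix (Fin n) (Fin n) ℂ} (hA : A.BlockTriangular b) (hB : B.BlockTriangular b)
    (j : Fin n) : (A * B) j j = A j j * B j j := by
  rw [Matrix.mul_apply]
  refine Finset.sum_eq_single j (fun k _ hk => ?_) (by simp)
  rcases lt_or_gt_of_ne (hb.ne hk) with h | h
  · rw [hA h, zero_mul]
  · rw [hB h, mul_zero]

theorem diag_mul_inv_diag_of_blockTriangular {b : Fin n → ℤ} (hb : Function.Injective b)
    {u : (Matrix (Fin n) (Fin n) ℂ)ˣ} (hu : u.val.BlockTriangular b) (j : Fin n) :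
    u.val j j * (u⁻¹).val j j = 1 := by
  rw [← blockTriangular_mul_diag hb hu (blockTriangular_units_inv hu)]
  simp

/-- The logarithms of the diagonal entries. -/
noncomputable def logDiag (g : GL3 n) : Fin 3 → Fin n → ℂ := fun i j => Complex.log ((g i).val j j)

/-- The `(p, q)` entry is scaled by `exp (s (b p - b q))`: triangularity kills the entries that
would grow, and the other off-diagonal ones decay. -/
theorem tendsto_conj_entry {b : Fin n → ℤ} (hb : Function.Injective b)
    {A : Matrix (Fin n) (Fin n) ℂ} (hA : A.BlockTriangular b) (p q : Fin n) :
    Tendsto (fun s : ℝ => Complex.exp (s * b p) * A p q * Complex.exp (-(s * b q))) atTop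
      (𝓝 (Matrix.diagonal (fun j => A j j) p q)) := by
  have e : ∀ s : ℝ, Complex.exp (s * b p) * A p q * Complex.exp (-(s * b q)) =
      ((Real.exp (s * (b p - b q : ℤ)) : ℝ) : ℂ) * A p q := fun s => by
    rw [mul_right_comm, ← Complex.exp_add]
    push_cast
    congr 2
    ring
  simp_rw [e]
  by_cases hpq : p = q
  · subst hpq
    simp
  · rw [diagonal_apply_ne _ hpq]
    rcases lt_or_gt_of_ne (hb.ne hpq) with h | h
    · have h1 : Tendsto (fun s : ℝ => Real.exp (s * (b p - b q : ℤ))) atTop (𝓝 0) := by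
        refine Real.tendsto_exp_atBot.comp ?_
        have : ((b p - b q : ℤ) : ℝ) < 0 := by exact_mod_cast (by omega)
        exact tendsto_id.atTop_mul_const_of_neg this
      have h2 := (Complex.continuous_ofReal.tendsto 0).comp h1
      simpa using h2.mul_const (A p q)
    · rw [hA h]
      simp

theorem tendsto_conj_regular {b : Fin n → ℤ} (hb : Function.Injective b) {g : GL3 n}
    (hg : ∀ i, (g i).val.BlockTriangular b) {F : GL3 n → ℂ} (hF : F ∈ regular n) :
    Tendsto (fun s : ℝ => F (expDiag (fun _ j => (s : ℂ) * b j) * g * expDiag (-fun _ j => (s : ℂ) * b j)))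
      atTop (𝓝 (F (expDiag (logDiag g)))) := by
  have hne : ∀ i j, (g i).val j j ≠ 0 := fun i j h0 => by
    have := diag_mul_inv_diag_of_blockTriangular hb (hg i) j
    simp [h0] at this
  refine tendsto_regular (fun i p q => ?_) (fun i p q => ?_) hF
  · convert tendsto_conj_entry hb (hg i) p q using 2 with s
    · simp [expDiag_val, Matrix.diagonal_mul, Matrix.mul_diagonal]
    · rw [expDiag_val]
      congr
      ext j
      exact Complex.exp_log (hne i j)
  · convert tendsto_conj_entry hb (blockTriangular_units_inv (hg i)) p q using 2 with s
    · rw [← expDiag_inv]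
      simp only [Pi.mul_apply, Pi.inv_apply, _root_.mul_inv_rev, inv_inv, Units.val_mul]
      rw [expDiag_val, expDiag_inv_val, ← mul_assoc, Matrix.mul_diagonal, Matrix.diagonal_mul]
    · rw [expDiag_inv_val]
      congr
      ext j
      rw [logDiag, Complex.exp_neg, Complex.exp_log (hne i j)]
      exact (eq_inv_of_mul_eq_one_right (diag_mul_inv_diag_of_blockTriangular hb (hg i) j)).symm

/-- Conjugation by `exp (s b)` scales the coefficient by `exp (s ⟨lam - mu, b⟩)` yet must converge
to its value on the diagonal part. A positive exponent forces the coefficient to vanish; for equal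
weights the scaling is trivial and the limit is the value. -/
theorem IsComplexification.covector_apply_triangular {ρ : Representation ℂ (K3 n) V}
    {R : Representation ℂ (GL3 n) V} (hR : IsComplexification ρ R) {b : Fin n → ℤ}
    (hb : Function.Injective b) {g : GL3 n} (hg : ∀ i, (g i).val.BlockTriangular b)
    {lam mu : Weight n} {v : V} (hv : v ∈ weightSpace ρ mu) {ξ : Module.Dual ℂ V}
    (hξ : IsWeightCovector ρ lam ξ) (h : lam = mu ∨ 0 < (lam - mu).pair b) :
    ξ (R g v) = mu.expChar (logDiag g) * ξ v := by
  have hlim := tendsto_conj_regular hb hg (hR.mem_regular ξ v)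
  have hval : ∀ s : ℝ, ξ (R (expDiag (fun _ j => (s : ℂ) * b j) * g * expDiag (-fun _ j => (s : ℂ) * b j)) v) =
      Complex.exp (s * (lam - mu).pair b) * ξ (R g v) := fun s => by
    rw [map_mul, map_mul, Module.End.mul_apply, Module.End.mul_apply, hR.apply_expDiag hv, map_smul,
      map_smul, map_smul, smul_eq_mul, hR.covector_apply_expDiag hξ, Weight.expChar_neg,
      Weight.expChar_cocharacter, Weight.expChar_cocharacter, sub_eq_add_neg, Weight.add_pair,
      Weight.neg_pair, ← Complex.exp_neg, ← mul_assoc, ← Complex.exp_add]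
    congr 2
    push_cast
    ring
  simp_rw [hval] at hlim
  rw [hR.apply_expDiag hv, map_smul, smul_eq_mul] at hlim
  rcases h with rfl | h
  · have h0 : (lam - lam).pair b = 0 := by simp [Weight.pair]
    simp only [h0, Int.cast_zero, mul_zero, Complex.exp_zero, one_mul] at hlim
    exact tendsto_nhds_unique tendsto_const_nhds hlim
  · have hne : lam ≠ mu := by
      rintro rfl
      simp [Weight.pair] at h
    have h1 : Tendsto (fun s : ℝ => Real.exp (-(s * ((lam - mu).pair b : ℤ)))) atTop (𝓝 0) := by
      refine Real.tendsto_exp_neg_atTop_nhds_zero.comp ?_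
      exact tendsto_id.atTop_mul_const (by exact_mod_cast h)
    have h2 := ((Complex.continuous_ofReal.tendsto 0).comp h1).mul hlim
    have h3 : ∀ s : ℝ, ((Real.exp (-(s * ((lam - mu).pair b : ℤ))) : ℝ) : ℂ) *
        (Complex.exp (s * (lam - mu).pair b) * ξ (R g v)) = ξ (R g v) := fun s => by
      rw [← mul_assoc]
      push_cast
      rw [← Complex.exp_add]
      simp
    simp only [Function.comp_apply, h3, Complex.ofReal_zero, zero_mul] at h2
    rw [hξ.apply_eq_zero hv hne, mul_zero]
    exact tendsto_nhds_unique tendsto_const_nhds h2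

end Contraction

/-! ### Highest weight coefficients via triangular factorisation. -/

section HighestWeight

open Matrix

variable {n : ℕ} {V : Type*} [AddCommGroup V] [Module ℂ V] [FiniteDimensional ℂ V]

/-- Test against weight covectors: a covector of weight `mu ≠ lam` has `mu - lam` positive on `j ↦
j`, so contraction applies. -/
theorem IsComplexification.apply_upper {ρ : Representation ℂ (K3 n) V}
    {R : Representation ℂ (GL3 n) V} (hρ : IsContinuousRep ρ) (hR : IsComplexification ρ R)
    {lam : Weight n} (hlam : HasHighestWeight ρ lam) {v : V} (hv : v ∈ weightSpace ρ lam)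
    {g : GL3 n} (hg : ∀ i, (g i).val.BlockTriangular fun j => (j : ℤ)) :
    R g v = lam.expChar (logDiag g) • v := by
  refine eq_of_weightCovectors hρ fun mu ξ hξ => ?_
  rw [map_smul, smul_eq_mul]
  by_cases h0 : ξ = 0
  · simp [h0]
  refine hR.covector_apply_triangular (fun i j h => by simpa [Fin.ext_iff] using h) hg hv hξ ?_
  rcases pair_neg_of_mem_cone (hlam.2 mu (hξ.weightSpace_ne_bot hρ h0)) with h | h
  · exact Or.inl (sub_eq_zero.mp h).symm
  · right
    rw [← neg_sub lam mu, Weight.neg_pair]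
    omega

theorem IsComplexification.covector_apply_lower {ρ : Representation ℂ (K3 n) V}
    {R : Representation ℂ (GL3 n) V} (hρ : IsContinuousRep ρ) (hR : IsComplexification ρ R)
    {lam : Weight n} (hlam : HasHighestWeight ρ lam) {ξ : Module.Dual ℂ V}
    (hξ : IsWeightCovector ρ lam ξ)
    {g : GL3 n} (hg : ∀ i, (g i).val.BlockTriangular fun j => -(j : ℤ)) (v : V) :
    ξ (R g v) = lam.expChar (logDiag g) * ξ v := by
  suffices h : ξ ∘ₗ R g = lam.expChar (logDiag g) • ξ from LinearMap.congr_fun h v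
  refine dual_eq_of_weightVectors hρ fun mu v hv => ?_
  rw [LinearMap.comp_apply, LinearMap.smul_apply, smul_eq_mul]
  by_cases h0 : v = 0
  · simp [h0]
  have hmu := hlam.2 mu ((Submodule.ne_bot_iff _).mpr ⟨v, hv, h0⟩)
  rw [hR.covector_apply_triangular (fun i j h => by simpa [Fin.ext_iff] using h) hg hv hξ ?_]
  · by_cases h : lam = mu
    · rw [h]
    · rw [hξ.apply_eq_zero hv h, mul_zero, mul_zero]
  · rcases pair_neg_of_mem_cone hmu with h | h
    · exact Or.inl (sub_eq_zero.mp h)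
    · right
      rw [Weight.pair_neg]
      omega

variable {V' : Type*} [AddCommGroup V'] [Module ℂ V'] [FiniteDimensional ℂ V']

open scoped ComplexOrder in
-- For real `x` the conjugate is positive definite, so it has a lower times upper factorisation.
theorem exists_lower_mul_upper_conj (k : K3 n) (x : Fin 3 → Fin n → ℝ) :
    ∃ L U : GL3 n, toGL3 n k * expDiag (fun i j => x i j) * toGL3 n k⁻¹ = L * U ∧
      (∀ i, (L i).val.BlockTriangular fun j => -(j : ℤ)) ∧
      ∀ i, (U i).val.BlockTriangular fun j => (j : ℤ) := by
  have h : ∀ i, ((toGL3 n k * expDiag (fun i j => x i j) * toGL3 n k⁻¹) i).val.PosDef := by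
    intro i
    change ((k i).val * diagonal (fun j => Complex.exp (x i j)) * star (k i).val).PosDef
    rw [Matrix.IsUnit.posDef_star_right_conjugate_iff (U := (k i).val) (toGL3 n k i).isUnit]
    refine Matrix.PosDef.diagonal fun j => ?_
    rw [← Complex.ofReal_exp]
    exact_mod_cast Real.exp_pos _
  choose L U h1 h2 h3 using fun i => exists_lower_mul_upper _ (h i)
  exact ⟨L, U, funext h1, h2, h3⟩

/-- The matrix coefficient of a highest weight vector and a highest weight covector only depends
on the weight, up to a scalar. -/
theorem highestWeight_coefficient {ρ : Representation ℂ (K3 n) V} {ρ' : Representation ℂ (K3 n) V'}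
    (hρ : IsContinuousRep ρ) (hρ' : IsContinuousRep ρ') {lam : Weight n}
    (hlam : HasHighestWeight ρ lam) (hlam' : HasHighestWeight ρ' lam)
    {v : V} (hv : v ∈ weightSpace ρ lam) {v' : V'} (hv' : v' ∈ weightSpace ρ' lam)
    {ξ : Module.Dual ℂ V} (hξ : IsWeightCovector ρ lam ξ)
    {ξ' : Module.Dual ℂ V'} (hξ' : IsWeightCovector ρ' lam ξ') (k : K3 n) :
    ξ (ρ k v) * ξ' v' = ξ' (ρ' k v') * ξ v := by
  obtain ⟨R, h1, h2⟩ := exists_complexification hρ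
  obtain ⟨R', h1', h2'⟩ := exists_complexification hρ'
  have hR : IsComplexification ρ R := ⟨h1, h2⟩
  have hR' : IsComplexification ρ' R' := ⟨h1', h2'⟩
  let D : GL3 n → ℂ := (ξ' v') • (fun g => ξ (R g v)) - (ξ v) • fun g => ξ' (R' g v')
  have hD : D ∈ regular n :=
    (regular n).sub_mem ((regular n).smul_mem (h2 ξ v) _) ((regular n).smul_mem (h2' ξ' v') _)
  obtain ⟨u, θ, hk⟩ := exists_toGL3_eq_conj k
  -- With `k = u exp(iθ) u⁻¹`, the curve `u exp(zθ) u⁻¹` is positive definite for real `z`, where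
  -- the triangular factors settle the identity, and equals `k` at `z = i`.
  have h0 := eq_zero_of_real (differentiable_regular_curve hD (toGL3 n u) (toGL3 n u⁻¹)
    (fun i j => (θ i j : ℂ)) 0) (fun t => ?_) Complex.I
  · have e : Complex.I • (fun (i : Fin 3) (j : Fin n) => (θ i j : ℂ)) + 0 =
        fun i j => θ i j * Complex.I := by
      ext i j
      simp [mul_comm]
    rw [e, ← hk] at h0
    simp only [D, Pi.sub_apply, Pi.smul_apply, smul_eq_mul, h1, h1'] at h0
    rw [mul_comm, sub_eq_zero.mp h0, mul_comm]
  · have e : (t : ℂ) • (fun (i : Fin 3) (j : Fin n) => (θ i j : ℂ)) + 0 =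
        fun i j => ((t * θ i j : ℝ) : ℂ) := by
      ext i j
      simp
    rw [e]
    obtain ⟨L, U, hLU, hL, hU⟩ := exists_lower_mul_upper_conj u fun i j => t * θ i j
    rw [hLU]
    simp only [D, Pi.sub_apply, Pi.smul_apply, smul_eq_mul, map_mul, Module.End.mul_apply,
      hR.apply_upper hρ hlam hv hU, hR'.apply_upper hρ' hlam' hv' hU, map_smul,
      hR.covector_apply_lower hρ hlam hξ hL, hR'.covector_apply_lower hρ' hlam' hξ' hL]
    ring

end HighestWeight

/-! ### Irreducible representations as spaces of matrix coefficients. -/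

section Irreducible

variable {n : ℕ} {V : Type*} [AddCommGroup V] [Module ℂ V]

/-- The vectors whose whole orbit lies in the kernel of `ξ` form a subrepresentation, which is
proper because `ξ ≠ 0`. -/
theorem eq_zero_of_forall_apply_eq_zero {ρ : Representation ℂ (K3 n) V} (hirr : ρ.IsIrreducible)
    {ξ : Module.Dual ℂ V} (hξ : ξ ≠ 0) {v : V} (h : ∀ k, ξ (ρ k v) = 0) : v = 0 := by
  let S : Subrepresentation ρ :=
    { toSubmodule :=
        { carrier := {w | ∀ k, ξ (ρ k w) = 0}
          add_mem' := fun ha hb k => by rw [map_add, map_add, ha k, hb k, add_zero]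
          zero_mem' := fun k => by simp
          smul_mem' := fun c w hw k => by rw [map_smul, map_smul, hw k, smul_zero] }
      apply_mem_toSubmodule := fun g w hw k => by
        rw [← Module.End.mul_apply, ← map_mul]
        exact hw _ }
  have hv : v ∈ S.toSubmodule := h
  rcases hirr.eq_bot_or_eq_top S with hS | hS
  · rw [hS] at hv
    exact hv
  · exfalso
    refine hξ (LinearMap.ext fun w => ?_)
    have hw : w ∈ S.toSubmodule := by
      rw [hS]
      exact Submodule.mem_top
    have := hw 1
    rwa [map_one] at this

theorem span_orbit_eq_top {ρ : Representation ℂ (K3 n) V} (hirr : ρ.IsIrreducible) {v : V}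
    (hv : v ≠ 0) : Submodule.span ℂ (Set.range fun k => ρ k v) = ⊤ := by
  let S : Subrepresentation ρ :=
    { toSubmodule := Submodule.span ℂ (Set.range fun k => ρ k v)
      apply_mem_toSubmodule := fun g w hw => by
        induction hw using Submodule.span_induction with
        | mem w h =>
          obtain ⟨k, rfl⟩ := h
          refine Submodule.subset_span ⟨g * k, ?_⟩
          simp
        | zero => simp
        | add x y _ _ hx hy => rw [map_add]; exact Submodule.add_mem _ hx hy
        | smul c x _ hx => rw [map_smul]; exact Submodule.smul_mem _ c hx }
  rcases hirr.eq_bot_or_eq_top S with hS | hS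
  · exfalso
    have : v ∈ S.toSubmodule := Submodule.subset_span ⟨1, by simp⟩
    rw [hS] at this
    exact hv this
  · exact congrArg Subrepresentation.toSubmodule hS

/-- The map sending a vector to its matrix coefficients with a given functional. -/
def coeffMap (ρ : Representation ℂ (K3 n) V) (ξ : Module.Dual ℂ V) : V →ₗ[ℂ] (K3 n → ℂ) where
  toFun v k := ξ (ρ k v)
  map_add' v w := by ext; simp
  map_smul' c v := by ext; simp

theorem coeffMap_injective {ρ : Representation ℂ (K3 n) V} (hirr : ρ.IsIrreducible)
    {ξ : Module.Dual ℂ V} (hξ : ξ ≠ 0) : Function.Injective (coeffMap ρ ξ) := by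
  rw [← LinearMap.ker_eq_bot, LinearMap.ker_eq_bot']
  exact fun v hv => eq_zero_of_forall_apply_eq_zero hirr hξ (congrFun hv)

theorem coeffMap_apply_apply (ρ : Representation ℂ (K3 n) V) (ξ : Module.Dual ℂ V) (g k : K3 n)
    (v : V) : coeffMap ρ ξ (ρ g v) k = coeffMap ρ ξ v (k * g) := by
  simp [coeffMap]

variable {V' : Type*} [AddCommGroup V'] [Module ℂ V']

/-- `coeffMap` turns the action into right translation of functions, and the orbit of `v` spans, so
one shared coefficient carries the whole range along. -/
theorem range_coeffMap_le {ρ : Representation ℂ (K3 n) V} {ρ' : Representation ℂ (K3 n) V'}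
    (hirr : ρ.IsIrreducible) {ξ : Module.Dual ℂ V} {ξ' : Module.Dual ℂ V'} {v : V} (hv : v ≠ 0)
    {v' : V'} (h : coeffMap ρ ξ v = coeffMap ρ' ξ' v') :
    LinearMap.range (coeffMap ρ ξ) ≤ LinearMap.range (coeffMap ρ' ξ') := by
  rw [LinearMap.range_eq_map, ← span_orbit_eq_top hirr hv, Submodule.map_span, Submodule.span_le]
  rintro _ ⟨_, ⟨g, rfl⟩, rfl⟩
  refine ⟨ρ' g v', funext fun k => ?_⟩
  rw [coeffMap_apply_apply, coeffMap_apply_apply, h]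

/-- Irreducible representations which share a nonzero matrix coefficient are isomorphic. -/
theorem nonempty_equiv_of_coeffMap_eq {ρ : Representation ℂ (K3 n) V}
    {ρ' : Representation ℂ (K3 n) V'} (hirr : ρ.IsIrreducible) (hirr' : ρ'.IsIrreducible)
    {ξ : Module.Dual ℂ V} (hξ : ξ ≠ 0) {ξ' : Module.Dual ℂ V'} (hξ' : ξ' ≠ 0) {v : V} (hv : v ≠ 0)
    {v' : V'} (hv' : v' ≠ 0) (h : coeffMap ρ ξ v = coeffMap ρ' ξ' v') :
    Nonempty (Representation.Equiv ρ ρ') := by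
  have hr : LinearMap.range (coeffMap ρ ξ) = LinearMap.range (coeffMap ρ' ξ') :=
    le_antisymm (range_coeffMap_le hirr hv h) (range_coeffMap_le hirr' hv' h.symm)
  let e : V ≃ₗ[ℂ] V' := (LinearEquiv.ofInjective _ (coeffMap_injective hirr hξ)).trans
    ((LinearEquiv.ofEq _ _ hr).trans
      (LinearEquiv.ofInjective _ (coeffMap_injective hirr' hξ')).symm)
  have he : ∀ x, coeffMap ρ' ξ' (e x) = coeffMap ρ ξ x := fun x => by
    have h1 : LinearEquiv.ofInjective _ (coeffMap_injective hirr' hξ') (e x) =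
        LinearEquiv.ofEq _ _ hr (LinearEquiv.ofInjective _ (coeffMap_injective hirr hξ) x) := by
      simp [e]
    exact congrArg Subtype.val h1
  refine ⟨Representation.Equiv.mk e fun g => LinearMap.ext fun x => ?_⟩
  refine coeffMap_injective hirr' hξ' (funext fun k => ?_)
  simp only [LinearMap.comp_apply, LinearEquiv.coe_coe]
  rw [he, coeffMap_apply_apply, coeffMap_apply_apply, he]

variable [FiniteDimensional ℂ V] [FiniteDimensional ℂ V']

/-- Irreducible representations with the same highest weight are isomorphic. -/
theorem nonempty_equiv_of_hasHighestWeight {ρ : Representation ℂ (K3 n) V}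
    {ρ' : Representation ℂ (K3 n) V'} (hρ : IsContinuousRep ρ) (hρ' : IsContinuousRep ρ')
    (hirr : ρ.IsIrreducible) (hirr' : ρ'.IsIrreducible) {lam : Weight n}
    (hlam : HasHighestWeight ρ lam) (hlam' : HasHighestWeight ρ' lam) :
    Nonempty (Representation.Equiv ρ ρ') := by
  obtain ⟨v, hv, hv0⟩ := (Submodule.ne_bot_iff _).mp hlam.1
  obtain ⟨v', hv', hv0'⟩ := (Submodule.ne_bot_iff _).mp hlam'.1
  obtain ⟨ξ, hξ, hξv⟩ := exists_weightCovector_apply_ne_zero hρ hv hv0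
  obtain ⟨ξ', hξ', hξv'⟩ := exists_weightCovector_apply_ne_zero hρ' hv' hv0'
  have hξ0 : ξ ≠ 0 := by
    rintro rfl
    exact hξv rfl
  have hξ0' : ξ' ≠ 0 := by
    rintro rfl
    exact hξv' rfl
  -- Rescaling each vector by the other pairing cancels the scalars in `highestWeight_coefficient`.
  refine nonempty_equiv_of_coeffMap_eq hirr hirr' hξ0 hξ0' (smul_ne_zero hξv' hv0)
    (smul_ne_zero hξv hv0') (funext fun k => ?_)
  have := highestWeight_coefficient hρ hρ' hlam hlam' hv hv' hξ hξ' k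
  simp only [coeffMap, map_smul, LinearMap.coe_mk, AddHom.coe_mk, Pi.smul_apply, smul_eq_mul]
  rw [mul_comm, this, mul_comm]

/-- The highest weight space of an irreducible representation is a line. -/
theorem highestWeight_proportional {ρ : Representation ℂ (K3 n) V} (hρ : IsContinuousRep ρ)
    (hirr : ρ.IsIrreducible) {lam : Weight n} (hlam : HasHighestWeight ρ lam) {v w : V}
    (hv : v ∈ weightSpace ρ lam) (hv0 : v ≠ 0) (hw : w ∈ weightSpace ρ lam) :
    ∃ c : ℂ, w = c • v := by
  obtain ⟨ξ, hξ, hξv⟩ := exists_weightCovector_apply_ne_zero hρ hv hv0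
  refine ⟨ξ w / ξ v, sub_eq_zero.mp ?_⟩
  have hξ0 : ξ ≠ 0 := by
    rintro rfl
    exact hξv rfl
  refine eq_zero_of_forall_apply_eq_zero hirr hξ0 fun k => ?_
  -- Subtracting the component seen by `ξ` leaves a highest weight vector killed by `ξ`; its
  -- coefficient function with `ξ` is then identically zero.
  have hu : w - (ξ w / ξ v) • v ∈ weightSpace ρ lam :=
    Submodule.sub_mem _ hw (Submodule.smul_mem _ _ hv)
  have hu0 : ξ (w - (ξ w / ξ v) • v) = 0 := by
    rw [map_sub, map_smul, smul_eq_mul, div_mul_cancel₀ _ hξv, sub_self]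
  have := highestWeight_coefficient hρ hρ hlam hlam hu hv hξ hξ k
  rw [hu0, mul_zero] at this
  exact (mul_eq_zero.mp this).resolve_right hξv

end Irreducible

/-! ### Weyl group symmetry of weights, and the dual representation. -/

section WeightCombinatorics

variable {n : ℕ} {V : Type*} [AddCommGroup V] [Module ℂ V]
  {V' : Type*} [AddCommGroup V'] [Module ℂ V']

theorem HasHighestWeight.unique {ρ : Representation ℂ (K3 n) V} {lam mu : Weight n}
    (h : HasHighestWeight ρ lam) (h' : HasHighestWeight ρ mu) : lam = mu := by
  have := eq_zero_of_add_eq_zero (h.2 mu h'.1) (h'.2 lam h.1) (by abel)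
  exact sub_eq_zero.mp this.1

theorem weightSpace_ne_bot_of_equiv {ρ : Representation ℂ (K3 n) V}
    {ρ' : Representation ℂ (K3 n) V'} (e : Representation.Equiv ρ ρ') {lam : Weight n}
    (h : weightSpace ρ lam ≠ ⊥) : weightSpace ρ' lam ≠ ⊥ := by
  obtain ⟨v, hv, hv0⟩ := (Submodule.ne_bot_iff _).mp h
  refine (Submodule.ne_bot_iff _).mpr ⟨e v, fun t => ?_, fun h0 => hv0 ?_⟩
  · have h1 := Representation.IntertwiningMap.isIntertwining _ _ e.toIntertwiningMap (torusElt t) v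
    rw [hv t, map_smul] at h1
    exact h1.symm
  · rw [← e.symm_apply_apply v, h0]
    exact map_zero e.symm.toLinearMap

theorem HasHighestWeight.of_equiv {ρ : Representation ℂ (K3 n) V}
    {ρ' : Representation ℂ (K3 n) V'} (e : Representation.Equiv ρ ρ') {lam : Weight n}
    (h : HasHighestWeight ρ lam) : HasHighestWeight ρ' lam :=
  ⟨weightSpace_ne_bot_of_equiv e h.1, fun mu hmu => h.2 mu (weightSpace_ne_bot_of_equiv e.symm hmu)⟩

/-- Triples of permutation matrices. -/
def weylElt (w : WeylGroup n) : K3 n := fun i =>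
  ⟨(w i).permMatrix ℂ, by
    rw [Matrix.mem_unitaryGroup_iff, Matrix.star_eq_conjTranspose, Matrix.conjTranspose_permMatrix,
      ← Matrix.permMatrix_mul]
    simp⟩

theorem torusElt_mul_weylElt (w : WeylGroup n) (t : Torus n) :
    torusElt t * weylElt w = weylElt w * torusElt fun i j => t i ((w i)⁻¹ j) := by
  ext1 i
  refine Subtype.ext (Matrix.ext fun a b => ?_)
  change (Matrix.diagonal (fun j => (t i j : ℂ)) * (w i).permMatrix ℂ) a b =
    ((w i).permMatrix ℂ * Matrix.diagonal fun j => (t i ((w i)⁻¹ j) : ℂ)) a b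
  rw [Matrix.diagonal_mul, Matrix.mul_diagonal]
  simp only [Equiv.Perm.permMatrix, PEquiv.toMatrix_apply, Equiv.toPEquiv_apply, Option.mem_some_iff]
  split_ifs with h
  · rw [← h, show (w i)⁻¹ (w i a) = a from (w i).symm_apply_apply a, mul_comm]
  · simp

/-- Permutation matrices normalise the torus, so they carry weight vectors to weight vectors. -/
theorem weightSpace_act_ne_bot {ρ : Representation ℂ (K3 n) V} {lam : Weight n}
    (h : weightSpace ρ lam ≠ ⊥) (w : WeylGroup n) : weightSpace ρ (w.act lam) ≠ ⊥ := by
  obtain ⟨v, hv, hv0⟩ := (Submodule.ne_bot_iff _).mp h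
  refine (Submodule.ne_bot_iff _).mpr ⟨ρ (weylElt w⁻¹) v, fun t => ?_, fun h0 => hv0 ?_⟩
  · rw [← Module.End.mul_apply, ← map_mul, torusElt_mul_weylElt, map_mul, Module.End.mul_apply, hv,
      map_smul]
    congr 1
    simp only [Weight.character, WeylGroup.act]
    refine Finset.prod_congr rfl fun i _ => ?_
    refine Fintype.prod_equiv (w i) _ _ fun j => ?_
    simp
  · have := congrArg (ρ (weylElt w⁻¹)⁻¹) h0
    rwa [← Module.End.mul_apply, ← map_mul, inv_mul_cancel, map_one, map_zero] at this

theorem WeylGroup.act_mul (w w' : WeylGroup n) (lam : Weight n) :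
    (w * w').act lam = w.act (w'.act lam) := by
  ext i j
  simp [act]

theorem WeylGroup.act_add (w : WeylGroup n) (lam mu : Weight n) :
    w.act (lam + mu) = w.act lam + w.act mu := rfl

theorem WeylGroup.act_neg (w : WeylGroup n) (lam : Weight n) : w.act (-lam) = -w.act lam := rfl

theorem WeylGroup.act_sub (w : WeylGroup n) (lam mu : Weight n) :
    w.act (lam - mu) = w.act lam - w.act mu := rfl

theorem WeylGroup.act_one (lam : Weight n) : (1 : WeylGroup n).act lam = lam := rfl

theorem w₀_mul_w₀ (n : ℕ) : w₀ n * w₀ n = 1 := by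
  ext i j
  simp [w₀]

/-- Reversing indices and negating sends `ε_j - ε_k` to `ε_{rev k} - ε_{rev j}`, again a positive
root. -/
theorem w₀_act_neg_mem_cone {α : Weight n} (h : α ∈ AddSubmonoid.closure (posRoots n)) :
    (w₀ n).act (-α) ∈ AddSubmonoid.closure (posRoots n) := by
  induction h using AddSubmonoid.closure_induction with
  | mem α h =>
    obtain ⟨i, j, k, hjk, rfl⟩ := h
    refine AddSubmonoid.subset_closure ⟨i, Fin.rev k, Fin.rev j, Fin.rev_lt_rev.mpr hjk, ?_⟩
    ext i' j'
    have e : ∀ x, (Pi.single x 1 : Fin n → ℤ) (Fin.rev j') = (Pi.single x.rev 1 : Fin n → ℤ) j' :=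
      fun x => by simp [Pi.single_apply, Fin.rev_eq_iff]
    by_cases hi : i' = i
    · subst hi
      simp [WeylGroup.act, w₀, ← e]
    · simp [WeylGroup.act, Pi.single_eq_of_ne hi]
  | zero => simp [show -(0 : Weight n) = 0 from neg_zero]; exact zero_mem _
  | add α β _ _ hα hβ =>
    rw [neg_add, WeylGroup.act_add]
    exact add_mem hα hβ

/-- Two highest weights that are conjugate under the Weyl group agree. -/
theorem HasHighestWeight.eq_of_act {ρ : Representation ℂ (K3 n) V}
    {ρ' : Representation ℂ (K3 n) V'} {lam mu : Weight n} (h : HasHighestWeight ρ lam)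
    (h' : HasHighestWeight ρ' mu) {w : WeylGroup n} (hw : mu = w.act lam) : lam = mu := by
  have h1 := h.2 mu (hw ▸ weightSpace_act_ne_bot h.1 w)
  have h2 : lam = w⁻¹.act mu := by rw [hw, ← WeylGroup.act_mul, inv_mul_cancel, WeylGroup.act_one]
  have h3 := h'.2 lam (h2 ▸ weightSpace_act_ne_bot h'.1 w⁻¹)
  exact sub_eq_zero.mp (eq_zero_of_add_eq_zero h1 h3 (by abel)).1

/-- The weights of the dual are the negatives of those of `ρ`, and `-w₀` preserves the positive
cone. -/
theorem HasHighestWeight.dual [FiniteDimensional ℂ V] {ρ : Representation ℂ (K3 n) V}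
    (hρ : IsContinuousRep ρ) {lam : Weight n} (h : HasHighestWeight ρ lam) :
    HasHighestWeight ρ.dual (-(w₀ n).act lam) := by
  constructor
  · obtain ⟨v, hv, hv0⟩ := (Submodule.ne_bot_iff _).mp (weightSpace_act_ne_bot h.1 (w₀ n))
    obtain ⟨ξ, hξ, hξv⟩ := exists_weightCovector_apply_ne_zero hρ hv hv0
    refine (Submodule.ne_bot_iff _).mpr ⟨ξ, mem_weightSpace_dual_iff.mpr hξ, ?_⟩
    rintro rfl
    exact hξv rfl
  · intro mu hmu
    obtain ⟨ξ, hξ, hξ0⟩ := (Submodule.ne_bot_iff _).mp hmu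
    rw [← neg_neg mu] at hξ
    have h1 := (mem_weightSpace_dual_iff.mp hξ).weightSpace_ne_bot hρ hξ0
    have h2 := w₀_act_neg_mem_cone (h.2 _ (weightSpace_act_ne_bot h1 (w₀ n)))
    rw [WeylGroup.act_neg, WeylGroup.act_sub, ← WeylGroup.act_mul, w₀_mul_w₀,
      WeylGroup.act_one] at h2
    convert h2 using 1
    abel

end WeightCombinatorics

/-! ### Averaging, complete reducibility and continuity of constructions. -/

section Constructions

variable {n : ℕ} {V V' : Type*} [AddCommGroup V] [Module ℂ V] [AddCommGroup V'] [Module ℂ V']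

theorem IsContinuousRep.toRepresentation {ρ : Representation ℂ (K3 n) V} (hρ : IsContinuousRep ρ)
    (S : Subrepresentation ρ) : IsContinuousRep S.toRepresentation := by
  intro v f
  obtain ⟨f', hf'⟩ := f.exists_extend
  have := hρ v f'
  rw [← hf']
  exact this

theorem isIrreducible_of_equiv {ρ : Representation ℂ (K3 n) V} {ρ' : Representation ℂ (K3 n) V'}
    (hirr : ρ.IsIrreducible) (e : Representation.Equiv ρ ρ') : ρ'.IsIrreducible := by
  have hn : Nontrivial (Subrepresentation ρ') := by
    refine ⟨⊥, ⊤, fun h => ?_⟩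
    refine bot_ne_top (α := Subrepresentation ρ) (Subrepresentation.toSubmodule_injective ?_)
    refine (eq_top_iff.mpr fun v _ => ?_ : (⊥ : Submodule ℂ V) = ⊤)
    have h1 : e v ∈ (⊥ : Subrepresentation ρ').toSubmodule := by
      rw [h]
      exact Submodule.mem_top
    rw [Submodule.mem_bot, ← e.symm_apply_apply v, show e v = 0 from h1]
    exact map_zero e.symm.toLinearMap
  refine { eq_bot_or_eq_top := fun S => ?_ }
  let S' : Subrepresentation ρ :=
    { toSubmodule := S.toSubmodule.comap e.toLinearMap
      apply_mem_toSubmodule := fun g v hv => by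
        have h := Representation.IntertwiningMap.isIntertwining _ _ e.toIntertwiningMap g v
        change e.toIntertwiningMap (ρ g v) ∈ S.toSubmodule
        rw [h]
        exact S.apply_mem_toSubmodule g hv }
  have hS : ∀ w, w ∈ S.toSubmodule ↔ e.symm w ∈ S'.toSubmodule := fun w => by
    change _ ↔ e (e.symm w) ∈ S.toSubmodule
    rw [e.apply_symm_apply]
  rcases hirr.eq_bot_or_eq_top S' with h | h
  · left
    refine Subrepresentation.toSubmodule_injective (eq_bot_iff.mpr fun w hw => ?_)
    rw [hS, h] at hw
    change w = 0
    rw [← e.apply_symm_apply w, show e.symm w = 0 from hw]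
    exact map_zero e.toLinearMap
  · right
    refine Subrepresentation.toSubmodule_injective (eq_top_iff.mpr fun w _ => ?_)
    rw [hS, h]
    exact Submodule.mem_top

variable [FiniteDimensional ℂ V']

/-- Averaging a linear map over the group. -/
theorem exists_average {ρ : Representation ℂ (K3 n) V} {ρ' : Representation ℂ (K3 n) V'}
    (hρ : IsContinuousRep ρ) (hρ' : IsContinuousRep ρ') (T : V →ₗ[ℂ] V') :
    ∃ A : V →ₗ[ℂ] V', (∀ g v, A (ρ g v) = ρ' g (A v)) ∧
      ∀ (v : V) (w : V'), (∀ g, ρ' g (T (ρ g⁻¹ v)) = w) → A v = w := by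
  have hF : ∀ (v : V) (l : Module.Dual ℂ V'), Continuous fun g => l (ρ' g (T (ρ g⁻¹ v))) := by
    intro v l
    let b := Module.finBasis ℂ V'
    have h : ∀ (g : K3 n) (w : V'), l (ρ' g w) = ∑ i, b.coord i w * l (ρ' g (b i)) := by
      intro g w
      conv_lhs => rw [← b.sum_repr w]
      simp only [map_sum, map_smul, smul_eq_mul]
      rfl
    rw [funext fun g : K3 n => h g (T (ρ g⁻¹ v))]
    exact continuous_finsetSum _ fun i _ =>
      ((hρ v (b.coord i ∘ₗ T)).comp continuous_inv).mul (hρ' (b i) l)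
  have hext : ∀ {w w' : V'}, (∀ l : Module.Dual ℂ V', l w = l w') → w = w' := fun h => by
    rw [← sub_eq_zero, ← Module.forall_dual_apply_eq_zero_iff ℂ]
    intro l
    rw [map_sub, h, sub_self]
  refine ⟨{ toFun := fun v => vecInt _ (hF v)
            map_add' := fun v w => hext fun l => ?_
            map_smul' := fun c v => hext fun l => ?_ }, fun g v => hext fun l => ?_,
    fun v w hw => hext fun l => ?_⟩
  · simp only [map_add, apply_vecInt]
    rw [← map_add]
    rfl
  · simp only [map_smul, apply_vecInt, RingHom.id_apply]
    rw [← map_smul]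
    rfl
  · change l (vecInt _ (hF _)) = (l ∘ₗ ρ' g) (vecInt _ (hF _))
    rw [apply_vecInt, apply_vecInt]
    refine (haarInt_translate g _ _ fun x => ?_).symm
    simp only [ContinuousMap.coe_mk, LinearMap.comp_apply]
    rw [← Module.End.mul_apply (ρ' g), ← map_mul, ← Module.End.mul_apply (ρ (g * x)⁻¹), ← map_mul]
    simp
  · change l (vecInt _ (hF _)) = l w
    rw [apply_vecInt]
    have : (⟨fun g => l (ρ' g (T (ρ g⁻¹ v))), hF v l⟩ : C(K3 n, ℂ)) = l w • 1 := by
      ext g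
      simp [hw g]
    rw [this, map_smul, haarInt_one, smul_eq_mul, mul_one]

variable [FiniteDimensional ℂ V]

theorem IsContinuousRep.tprod {ρ : Representation ℂ (K3 n) V} {ρ' : Representation ℂ (K3 n) V'}
    (hρ : IsContinuousRep ρ) (hρ' : IsContinuousRep ρ') : IsContinuousRep (ρ.tprod ρ') := by
  intro x f
  induction x using TensorProduct.induction_on with
  | zero =>
    simp only [map_zero]
    exact continuous_const
  | tmul v v' =>
    let b := Module.finBasis ℂ V
    let b' := Module.finBasis ℂ V'
    have h : ∀ (w : V) (w' : V'), f (w ⊗ₜ w') =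
        ∑ i, ∑ j, b.coord i w * b'.coord j w' * f (b i ⊗ₜ b' j) := by
      intro w w'
      conv_lhs => rw [← b.sum_repr w, ← b'.sum_repr w']
      simp only [TensorProduct.sum_tmul, TensorProduct.tmul_sum, TensorProduct.smul_tmul_smul,
        map_sum, map_smul, smul_eq_mul]
      exact Finset.sum_comm
    simp only [Representation.tprod_apply, TensorProduct.map_tmul]
    rw [funext fun g : K3 n => h (ρ g v) (ρ' g v')]
    exact continuous_finsetSum _ fun i _ => continuous_finsetSum _ fun j _ =>
      ((hρ v (b.coord i)).mul (hρ' v' (b'.coord j))).mul continuous_const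
  | add x y hx hy =>
    simp only [map_add]
    exact hx.add hy

/-- Complete reducibility: every subrepresentation is the image of an equivariant projection. -/
theorem exists_equivariant_projection {ρ : Representation ℂ (K3 n) V} (hρ : IsContinuousRep ρ)
    (S : Subrepresentation ρ) : ∃ p : V →ₗ[ℂ] S.toSubmodule,
      (∀ g v, p (ρ g v) = S.toRepresentation g (p v)) ∧ ∀ v : S.toSubmodule, p v = v := by
  obtain ⟨π, hπ⟩ := S.toSubmodule.subtype.exists_leftInverse_of_injective (Submodule.ker_subtype _)
  obtain ⟨A, hA, hA'⟩ := exists_average hρ (hρ.toRepresentation S) π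
  refine ⟨A, hA, fun v => hA' _ _ fun g => ?_⟩
  have h1 : π (S.toRepresentation g⁻¹ v) = S.toRepresentation g⁻¹ v :=
    LinearMap.congr_fun hπ (S.toRepresentation g⁻¹ v)
  change S.toRepresentation g (π (S.toRepresentation g⁻¹ v)) = v
  rw [h1, ← Module.End.mul_apply, ← map_mul, mul_inv_cancel, map_one]
  rfl

theorem continuous_diag (n : ℕ) : Continuous (diag n) := continuous_pi fun _ => continuous_id

/-- Invariant functionals are determined by their values on invariant vectors. -/
theorem exists_invariant_apply_eq {ρ : Representation ℂ (K3 n) V} (hρ : IsContinuousRep ρ)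
    {φ : Module.Dual ℂ V} (hφ : IsKInvariant ρ φ) (v : V) :
    ∃ w ∈ invariantsK ρ, φ w = φ v := by
  have hF : ∀ l : Module.Dual ℂ V, Continuous fun k : K n => l (ρ (diag n k) v) := fun l =>
    (hρ v l).comp (continuous_diag n)
  refine ⟨vecInt _ hF, fun k => ?_, ?_⟩
  · rw [← sub_eq_zero, ← Module.forall_dual_apply_eq_zero_iff ℂ]
    intro l
    rw [map_sub, sub_eq_zero]
    change (l ∘ₗ ρ (diag n k)) (vecInt _ hF) = l _
    rw [apply_vecInt, apply_vecInt]
    refine haarInt_translate k _ _ fun x => ?_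
    simp
  · rw [apply_vecInt]
    have : (⟨fun k => φ (ρ (diag n k) v), hF φ⟩ : C(K n, ℂ)) = φ v • 1 := by
      ext k
      simp [hφ k v]
    rw [this, map_smul, haarInt_one, smul_eq_mul, mul_one]

end Constructions

/-! ### The top weight of a tensor product and the Cartan projection. -/

section Tensor

variable {n : ℕ} {V₁ V₂ : Type*} [AddCommGroup V₁] [Module ℂ V₁] [AddCommGroup V₂] [Module ℂ V₂]
  {σ₁ : Representation ℂ (K3 n) V₁} {σ₂ : Representation ℂ (K3 n) V₂}

theorem tmul_mem_weightSpace {lam mu : Weight n} {v : V₁} {w : V₂} (hv : v ∈ weightSpace σ₁ lam)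
    (hw : w ∈ weightSpace σ₂ mu) : v ⊗ₜ[ℂ] w ∈ weightSpace (σ₁.tprod σ₂) (lam + mu) := by
  intro t
  rw [Representation.tprod_apply, TensorProduct.map_tmul, hv t, hw t, TensorProduct.smul_tmul_smul,
    Weight.character_add]

theorem IsWeightCovector.dualDistrib_tmul {lam mu : Weight n} {ξ : Module.Dual ℂ V₁}
    {η : Module.Dual ℂ V₂} (hξ : IsWeightCovector σ₁ lam ξ) (hη : IsWeightCovector σ₂ mu η) :
    IsWeightCovector (σ₁.tprod σ₂) (lam + mu) (TensorProduct.dualDistrib ℂ V₁ V₂ (ξ ⊗ₜ η)) := by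
  intro t x
  rw [Weight.character_add]
  induction x using TensorProduct.induction_on with
  | zero => simp
  | tmul v w =>
    simp only [Representation.tprod_apply, TensorProduct.map_tmul,
      TensorProduct.dualDistrib_apply, hξ t v, hη t w]
    ring
  | add x y hx hy => rw [map_add, map_add, hx, hy, map_add, mul_add]

variable [FiniteDimensional ℂ V₁] [FiniteDimensional ℂ V₂]

/-- On a tensor product of irreducible representations, a covector of highest possible weight is
determined by its value on the tensor product of the highest weight vectors. -/
theorem IsWeightCovector.eq_zero_of_tmul (hc₁ : IsContinuousRep σ₁) (hc₂ : IsContinuousRep σ₂)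
    (hirr₁ : σ₁.IsIrreducible) (hirr₂ : σ₂.IsIrreducible) {lam mu : Weight n}
    (hlam : HasHighestWeight σ₁ lam) (hmu : HasHighestWeight σ₂ mu)
    {v₁ : V₁} (hv₁ : v₁ ∈ weightSpace σ₁ lam) (hv₁0 : v₁ ≠ 0)
    {v₂ : V₂} (hv₂ : v₂ ∈ weightSpace σ₂ mu) (hv₂0 : v₂ ≠ 0)
    {η : Module.Dual ℂ (V₁ ⊗[ℂ] V₂)} (hη : IsWeightCovector (σ₁.tprod σ₂) (lam + mu) η)
    (h : η (v₁ ⊗ₜ v₂) = 0) : η = 0 := by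
  refine TensorProduct.ext (dual_eq_of_weightVectors hc₁ fun α a ha =>
    dual_eq_of_weightVectors hc₂ fun β b hb => ?_)
  change η (a ⊗ₜ b) = 0
  by_cases ha0 : a = 0
  · simp [ha0]
  by_cases hb0 : b = 0
  · simp [hb0]
  by_cases hαβ : lam + mu = α + β
  -- Both `lam - α` and `mu - β` lie in the pointed cone and their sum is zero, so both vanish and
  -- only the product of highest weight lines contributes.
  · obtain ⟨h1, h2⟩ := eq_zero_of_add_eq_zero
      (hlam.2 α ((Submodule.ne_bot_iff _).mpr ⟨a, ha, ha0⟩))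
      (hmu.2 β ((Submodule.ne_bot_iff _).mpr ⟨b, hb, hb0⟩))
      (by rw [sub_add_sub_comm, hαβ, sub_self])
    rw [← sub_eq_zero.mp h1] at ha
    rw [← sub_eq_zero.mp h2] at hb
    obtain ⟨c, rfl⟩ := highestWeight_proportional hc₁ hirr₁ hlam hv₁ hv₁0 ha
    obtain ⟨d, rfl⟩ := highestWeight_proportional hc₂ hirr₂ hmu hv₂ hv₂0 hb
    rw [TensorProduct.smul_tmul_smul, map_smul, h, smul_zero]
  · exact hη.apply_eq_zero (tmul_mem_weightSpace ha hb) hαβ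

theorem exists_eq_smul_of_weightCovector (hc₁ : IsContinuousRep σ₁) (hc₂ : IsContinuousRep σ₂)
    (hirr₁ : σ₁.IsIrreducible) (hirr₂ : σ₂.IsIrreducible) {lam mu : Weight n}
    (hlam : HasHighestWeight σ₁ lam) (hmu : HasHighestWeight σ₂ mu)
    {η η' : Module.Dual ℂ (V₁ ⊗[ℂ] V₂)} (hη : IsWeightCovector (σ₁.tprod σ₂) (lam + mu) η)
    (hη0 : η ≠ 0) (hη' : IsWeightCovector (σ₁.tprod σ₂) (lam + mu) η') : ∃ c : ℂ, η' = c • η := by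
  obtain ⟨v₁, hv₁, hv₁0⟩ := (Submodule.ne_bot_iff _).mp hlam.1
  obtain ⟨v₂, hv₂, hv₂0⟩ := (Submodule.ne_bot_iff _).mp hmu.1
  have hne : η (v₁ ⊗ₜ v₂) ≠ 0 := fun h => hη0
    (hη.eq_zero_of_tmul hc₁ hc₂ hirr₁ hirr₂ hlam hmu hv₁ hv₁0 hv₂ hv₂0 h)
  refine ⟨η' (v₁ ⊗ₜ v₂) / η (v₁ ⊗ₜ v₂), sub_eq_zero.mp ?_⟩
  refine IsWeightCovector.eq_zero_of_tmul hc₁ hc₂ hirr₁ hirr₂ hlam hmu hv₁ hv₁0 hv₂ hv₂0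
    (fun t x => ?_) ?_
  · simp only [LinearMap.sub_apply, LinearMap.smul_apply, smul_eq_mul, hη t x, hη' t x]
    ring
  · rw [LinearMap.sub_apply, LinearMap.smul_apply, smul_eq_mul, div_mul_cancel₀ _ hne, sub_self]

variable {W : Type*} [AddCommGroup W] [Module ℂ W] [FiniteDimensional ℂ W]
  {τ : Representation ℂ (K3 n) W}

/-- Equivariant maps onto the Cartan component are unique up to scalars. -/
theorem exists_eq_smul_of_equivariant (hc₁ : IsContinuousRep σ₁) (hc₂ : IsContinuousRep σ₂)
    (hc : IsContinuousRep τ) (hirr₁ : σ₁.IsIrreducible) (hirr₂ : σ₂.IsIrreducible)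
    (hirr : τ.IsIrreducible) {lam mu : Weight n}
    (hlam : HasHighestWeight σ₁ lam) (hmu : HasHighestWeight σ₂ mu)
    (hτ : HasHighestWeight τ (lam + mu)) {p q : V₁ ⊗[ℂ] V₂ →ₗ[ℂ] W}
    (hp : ∀ g x, p (σ₁.tprod σ₂ g x) = τ g (p x)) (hp0 : Function.Surjective p)
    (hq : ∀ g x, q (σ₁.tprod σ₂ g x) = τ g (q x)) : ∃ c : ℂ, q = c • p := by
  obtain ⟨w, hw, hw0⟩ := (Submodule.ne_bot_iff _).mp hτ.1
  obtain ⟨ξ, hξ, hξw⟩ := exists_weightCovector_apply_ne_zero hc hw hw0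
  have hξ0 : ξ ≠ 0 := by
    rintro rfl
    exact hξw rfl
  have hξp : ξ ∘ₗ p ≠ 0 := fun h => by
    obtain ⟨x, rfl⟩ := hp0 w
    exact hξw (LinearMap.congr_fun h x)
  -- After composing with a highest weight covector of `τ`, both maps land on one line of covectors;
  -- irreducibility of `τ` lifts proportionality back to the maps.
  obtain ⟨c, hcc⟩ := exists_eq_smul_of_weightCovector hc₁ hc₂ hirr₁ hirr₂ hlam hmu
    (η := ξ ∘ₗ p) (η' := ξ ∘ₗ q) (fun t x => by simp only [LinearMap.comp_apply, hp, hξ t]) hξp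
    (fun t x => by simp only [LinearMap.comp_apply, hq, hξ t])
  refine ⟨c, LinearMap.ext fun x => sub_eq_zero.mp ?_⟩
  refine eq_zero_of_forall_apply_eq_zero hirr hξ0 fun k => ?_
  have := LinearMap.congr_fun hcc (σ₁.tprod σ₂ k x)
  simp only [LinearMap.comp_apply, LinearMap.smul_apply, smul_eq_mul, hp, hq] at this
  rw [LinearMap.smul_apply, map_sub, map_smul, map_sub, map_smul, this, smul_eq_mul, sub_self]

/-- The projection of a nonzero pure tensor to the Cartan component does not vanish. -/
theorem cartan_projection_tmul_ne_zero (hc₁ : IsContinuousRep σ₁) (hc₂ : IsContinuousRep σ₂)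
    (hc : IsContinuousRep τ) (hirr₁ : σ₁.IsIrreducible) (hirr₂ : σ₂.IsIrreducible)
    {lam mu : Weight n} (hlam : HasHighestWeight σ₁ lam) (hmu : HasHighestWeight σ₂ mu)
    (hτ : HasHighestWeight τ (lam + mu)) {p : V₁ ⊗[ℂ] V₂ →ₗ[ℂ] W}
    (hp : ∀ g x, p (σ₁.tprod σ₂ g x) = τ g (p x)) (hp0 : Function.Surjective p)
    {u₁ : V₁} (hu₁ : u₁ ≠ 0) {u₂ : V₂} (hu₂ : u₂ ≠ 0) : p (u₁ ⊗ₜ u₂) ≠ 0 := by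
  intro hzero
  obtain ⟨w, hw, hw0⟩ := (Submodule.ne_bot_iff _).mp hτ.1
  obtain ⟨ξ, hξ, hξw⟩ := exists_weightCovector_apply_ne_zero hc hw hw0
  have hξp : ξ ∘ₗ p ≠ 0 := fun h => by
    obtain ⟨x, rfl⟩ := hp0 w
    exact hξw (LinearMap.congr_fun h x)
  obtain ⟨v₁, hv₁, hv₁0⟩ := (Submodule.ne_bot_iff _).mp hlam.1
  obtain ⟨v₂, hv₂, hv₂0⟩ := (Submodule.ne_bot_iff _).mp hmu.1
  obtain ⟨ξ₁, hξ₁, hξv₁⟩ := exists_weightCovector_apply_ne_zero hc₁ hv₁ hv₁0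
  obtain ⟨ξ₂, hξ₂, hξv₂⟩ := exists_weightCovector_apply_ne_zero hc₂ hv₂ hv₂0
  obtain ⟨c, hcc⟩ := exists_eq_smul_of_weightCovector hc₁ hc₂ hirr₁ hirr₂ hlam hmu
    (η := ξ ∘ₗ p) (fun t x => by simp only [LinearMap.comp_apply, hp, hξ t]) hξp
    (hξ₁.dualDistrib_tmul hξ₂)
  have hprod : ∀ k, ξ₁ (σ₁ k u₁) * ξ₂ (σ₂ k u₂) = 0 := fun k => by
    have := LinearMap.congr_fun hcc (σ₁.tprod σ₂ k (u₁ ⊗ₜ u₂))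
    rw [LinearMap.smul_apply, LinearMap.comp_apply, hp, hzero, map_zero, map_zero, smul_zero,
      Representation.tprod_apply, TensorProduct.map_tmul, TensorProduct.dualDistrib_apply] at this
    exact this
  obtain ⟨R₁, hR₁, hreg₁⟩ := exists_complexification hc₁
  obtain ⟨R₂, hR₂, hreg₂⟩ := exists_complexification hc₂
  -- Two regular functions with zero product on `K³`: one vanishes, and irreducibility kills the
  -- corresponding vector.
  rcases regular_eq_zero_or_eq_zero (hreg₁ ξ₁ u₁) (hreg₂ ξ₂ u₂)
    (fun k => by rw [hR₁, hR₂, hprod]) with h | h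
  · refine hu₁ (eq_zero_of_forall_apply_eq_zero hirr₁ (ξ := ξ₁) ?_ fun k => by rw [← hR₁, h])
    rintro rfl
    exact hξv₁ rfl
  · refine hu₂ (eq_zero_of_forall_apply_eq_zero hirr₂ (ξ := ξ₂) ?_ fun k => by rw [← hR₂, h])
    rintro rfl
    exact hξv₂ rfl

end Tensor

/-! ### Adjunction between `V₁ ⊗ V₂ → W` and `V₂ → V₁* ⊗ W`. -/

section HomTensor

variable {n : ℕ} {V₁ V₂ W : Type*} [AddCommGroup V₁] [Module ℂ V₁]
  [AddCommGroup V₂] [Module ℂ V₂] [AddCommGroup W] [Module ℂ W]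

theorem dualTensorHom_equivariant (σ₁ : Representation ℂ (K3 n) V₁)
    (τ : Representation ℂ (K3 n) W) (g : K3 n) (x : Module.Dual ℂ V₁ ⊗[ℂ] W) (v : V₁) :
    dualTensorHom ℂ V₁ W (σ₁.dual.tprod τ g x) v = τ g (dualTensorHom ℂ V₁ W x (σ₁ g⁻¹ v)) :=
  LinearMap.congr_fun (LinearMap.congr_fun (Representation.dualTensorHom_comm σ₁ τ g) x) v

variable [FiniteDimensional ℂ V₁]

/-- The linear map `V₂ → V₁* ⊗ W` adjoint to `V₁ ⊗ V₂ → W`. -/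
noncomputable def toDualTensor (p : V₁ ⊗[ℂ] V₂ →ₗ[ℂ] W) : V₂ →ₗ[ℂ] Module.Dual ℂ V₁ ⊗[ℂ] W :=
  (dualTensorHomEquiv ℂ V₁ W).symm.toLinearMap ∘ₗ (TensorProduct.curry p).flip

theorem dualTensorHom_toDualTensor (p : V₁ ⊗[ℂ] V₂ →ₗ[ℂ] W) (v₂ : V₂) (v₁ : V₁) :
    dualTensorHom ℂ V₁ W (toDualTensor p v₂) v₁ = p (v₁ ⊗ₜ v₂) := by
  have h : dualTensorHomEquiv ℂ V₁ W (toDualTensor p v₂) = (TensorProduct.curry p).flip v₂ :=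
    (dualTensorHomEquiv ℂ V₁ W).apply_symm_apply _
  exact LinearMap.congr_fun h v₁

theorem dualTensorHom_injective : Function.Injective (dualTensorHom ℂ V₁ W) :=
  (dualTensorHomEquiv ℂ V₁ W).injective

theorem toDualTensor_equivariant {σ₁ : Representation ℂ (K3 n) V₁}
    {σ₂ : Representation ℂ (K3 n) V₂} {τ : Representation ℂ (K3 n) W} {p : V₁ ⊗[ℂ] V₂ →ₗ[ℂ] W}
    (hp : ∀ g x, p (σ₁.tprod σ₂ g x) = τ g (p x)) (g : K3 n) (v : V₂) :
    toDualTensor p (σ₂ g v) = σ₁.dual.tprod τ g (toDualTensor p v) := by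
  refine dualTensorHom_injective (LinearMap.ext fun v₁ => ?_)
  rw [dualTensorHom_equivariant, dualTensorHom_toDualTensor, dualTensorHom_toDualTensor, ← hp,
    Representation.tprod_apply, TensorProduct.map_tmul, ← Module.End.mul_apply, ← map_mul,
    mul_inv_cancel, map_one, Module.End.one_apply]

/-- The converse half of the adjunction, which turns the embedding of an arbitrary PRV component
into a map that can be compared with the Cartan projection. -/
theorem exists_eq_toDualTensor {σ₁ : Representation ℂ (K3 n) V₁}
    {σ₂ : Representation ℂ (K3 n) V₂} {τ : Representation ℂ (K3 n) W}
    {j : V₂ →ₗ[ℂ] Module.Dual ℂ V₁ ⊗[ℂ] W}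
    (hj : ∀ g v, j (σ₂ g v) = σ₁.dual.tprod τ g (j v)) :
    ∃ p : V₁ ⊗[ℂ] V₂ →ₗ[ℂ] W, (∀ g x, p (σ₁.tprod σ₂ g x) = τ g (p x)) ∧ j = toDualTensor p := by
  let p : V₁ ⊗[ℂ] V₂ →ₗ[ℂ] W := TensorProduct.lift (dualTensorHom ℂ V₁ W ∘ₗ j).flip
  have hp : ∀ v₁ v₂, p (v₁ ⊗ₜ v₂) = dualTensorHom ℂ V₁ W (j v₂) v₁ := fun v₁ v₂ => by
    simp [p]
  refine ⟨p, fun g x => ?_, ?_⟩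
  · induction x using TensorProduct.induction_on with
    | zero => simp
    | tmul v₁ v₂ =>
      rw [Representation.tprod_apply, TensorProduct.map_tmul, hp, hj, dualTensorHom_equivariant, hp,
        ← Module.End.mul_apply (σ₁ g⁻¹), ← map_mul, inv_mul_cancel, map_one, Module.End.one_apply]
    | add x y hx hy => rw [map_add, map_add, hx, hy, map_add, map_add]
  · refine LinearMap.ext fun v₂ => dualTensorHom_injective (LinearMap.ext fun v₁ => ?_)
    rw [dualTensorHom_toDualTensor, hp]

theorem toDualTensor_smul (c : ℂ) (p : V₁ ⊗[ℂ] V₂ →ₗ[ℂ] W) :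
    toDualTensor (c • p) = c • toDualTensor p := by
  refine LinearMap.ext fun v₂ => dualTensorHom_injective (LinearMap.ext fun v₁ => ?_)
  rw [dualTensorHom_toDualTensor, LinearMap.smul_apply, LinearMap.smul_apply, map_smul,
    LinearMap.smul_apply, dualTensorHom_toDualTensor]

/-- Viewing a tensor as a linear map, evaluation at `u` in the first factor applies that map to `u`;
this is how `φ₁ ⊗ φ₃` on `j u₂` becomes `φ₃ (p (u₁ ⊗ u₂))`. -/
theorem dualDistrib_apply_eq_dualTensorHom (u : V₁) (φ : Module.Dual ℂ W)
    (x : Module.Dual ℂ V₁ ⊗[ℂ] W) :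
    TensorProduct.dualDistrib ℂ (Module.Dual ℂ V₁) W (Module.evalEquiv ℂ V₁ u ⊗ₜ φ) x =
      φ (dualTensorHom ℂ V₁ W x u) := by
  induction x using TensorProduct.induction_on with
  | zero => simp
  | tmul ξ w => simp
  | add x y hx hy => rw [map_add, hx, hy, map_add, LinearMap.add_apply, map_add]

end HomTensor

/-! ### Invariant functionals and invariant vectors. -/

section Invariants

variable {n : ℕ} {V : Type*} [AddCommGroup V] [Module ℂ V] [FiniteDimensional ℂ V]

/-- An invariant functional on the dual is evaluation at an invariant vector. -/
theorem IsKInvariant.evalEquiv_symm_mem {ρ : Representation ℂ (K3 n) V}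
    {φ : Module.Dual ℂ (Module.Dual ℂ V)} (hφ : IsKInvariant ρ.dual φ) :
    (Module.evalEquiv ℂ V).symm φ ∈ invariantsK ρ := by
  intro k
  rw [← sub_eq_zero, ← Module.forall_dual_apply_eq_zero_iff ℂ]
  intro ξ
  rw [map_sub, sub_eq_zero, Module.apply_evalEquiv_symm_apply, ← hφ k⁻¹]
  have h : ρ.dual (diag n k⁻¹) ξ = ξ ∘ₗ ρ (diag n k) := by
    rw [Representation.dual_apply, ← map_inv, inv_inv]
    rfl
  rw [h]
  exact Module.apply_evalEquiv_symm_apply ℂ V (ξ ∘ₗ ρ (diag n k)) φ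

/-- If the invariants form a line, a nonzero invariant functional does not vanish on nonzero
invariant vectors. -/
theorem IsKInvariant.apply_ne_zero {ρ : Representation ℂ (K3 n) V} (hρ : IsContinuousRep ρ)
    (hd : Module.finrank ℂ (invariantsK ρ) = 1) {φ : Module.Dual ℂ V} (hφ : IsKInvariant ρ φ)
    (hφ0 : φ ≠ 0) {w : V} (hw : w ∈ invariantsK ρ) (hw0 : w ≠ 0) : φ w ≠ 0 := by
  intro h0
  refine hφ0 (LinearMap.ext fun x => ?_)
  obtain ⟨y, hy, hyx⟩ := exists_invariant_apply_eq hρ hφ x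
  obtain ⟨c, hc⟩ := exists_smul_eq_of_finrank_eq_one hd
    (x := (⟨w, hw⟩ : invariantsK ρ)) (fun h => hw0 (congrArg Subtype.val h)) ⟨y, hy⟩
  have hc' : c • w = y := congrArg Subtype.val hc
  rw [← hyx, ← hc', map_smul, h0, smul_zero]
  rfl

end Invariants

end PRV

/-! ### The proposition. -/

open PRV in
theorem mainTheorem7 (n : ℕ)
    {V₁ V₂ : Type*} [AddCommGroup V₁] [Module ℂ V₁] [FiniteDimensional ℂ V₁]
    [AddCommGroup V₂] [Module ℂ V₂] [FiniteDimensional ℂ V₂]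
    (σ₁ : Representation ℂ (PRV.K3 n) V₁) (σ₂ : Representation ℂ (PRV.K3 n) V₂)
    (hc₁ : PRV.IsContinuousRep σ₁) (hc₂ : PRV.IsContinuousRep σ₂)
    (hirr₁ : σ₁.IsIrreducible) (hirr₂ : σ₂.IsIrreducible)
    (σ₃ : Subrepresentation (σ₁.tprod σ₂)) (hσ₃ : PRV.IsCartanComponent σ₁ σ₂ σ₃)
    (hd₁ : Module.finrank ℂ (PRV.invariantsK σ₁) = 1)
    (hd₂ : Module.finrank ℂ (PRV.invariantsK σ₂) = 1)
    (hd₃ : Module.finrank ℂ (PRV.invariantsK σ₃.toRepresentation) = 1)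
    (φ₁ : Module.Dual ℂ (Module.Dual ℂ V₁)) (φ₃ : Module.Dual ℂ σ₃.toSubmodule)
    (hφ₁ : PRV.IsKInvariant σ₁.dual φ₁) (hφ₃ : PRV.IsKInvariant σ₃.toRepresentation φ₃)
    (hφ₁0 : φ₁ ≠ 0) (hφ₃0 : φ₃ ≠ 0) :
    ∃ P : Subrepresentation (σ₁.dual.tprod σ₃.toRepresentation),
      (∀ Q : Subrepresentation (σ₁.dual.tprod σ₃.toRepresentation),
        PRV.IsPRVComponent σ₁.dual σ₃.toRepresentation Q ↔ Q = P) ∧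
      Nonempty (Representation.Equiv σ₂ P.toRepresentation) ∧
      ∃ x ∈ P.toSubmodule,
        TensorProduct.dualDistrib ℂ (Module.Dual ℂ V₁) σ₃.toSubmodule (φ₁ ⊗ₜ[ℂ] φ₃) x ≠ 0 := by
  have hc₃ := (hc₁.tprod hc₂).toRepresentation σ₃
  obtain ⟨hirr₃, lam, mu, h₁, h₂, h₃⟩ := hσ₃
  obtain ⟨p, hp, hpid⟩ := exists_equivariant_projection (hc₁.tprod hc₂) σ₃
  have hps : Function.Surjective p := fun v => ⟨v, hpid v⟩
  let u₁ : V₁ := (Module.evalEquiv ℂ V₁).symm φ₁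
  have hu₁ : u₁ ∈ invariantsK σ₁ := hφ₁.evalEquiv_symm_mem
  have hu₁0 : u₁ ≠ 0 := fun h => hφ₁0 ((Module.evalEquiv ℂ V₁).symm.map_eq_zero_iff.mp h)
  obtain ⟨⟨u₂, hu₂⟩, hu₂0, -⟩ := finrank_eq_one_iff'.mp hd₂
  replace hu₂0 : u₂ ≠ 0 := fun h => hu₂0 (Subtype.ext h)
  have hw0 : p (u₁ ⊗ₜ u₂) ≠ 0 := cartan_projection_tmul_ne_zero hc₁ hc₂ hc₃ hirr₁ hirr₂
    h₁ h₂ h₃ hp hps hu₁0 hu₂0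
  have hw : p (u₁ ⊗ₜ u₂) ∈ invariantsK σ₃.toRepresentation := fun k => by
    change σ₃.toRepresentation (diag n k) (p (u₁ ⊗ₜ u₂)) = p (u₁ ⊗ₜ u₂)
    rw [← hp, Representation.tprod_apply, TensorProduct.map_tmul]
    exact congrArg p (congrArg₂ _ (hu₁ k) (hu₂ k))
  have hφw : φ₃ (p (u₁ ⊗ₜ u₂)) ≠ 0 := hφ₃.apply_ne_zero hc₃ hd₃ hφ₃0 hw hw0
  let j : Representation.IntertwiningMap σ₂ (σ₁.dual.tprod σ₃.toRepresentation) :=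
    (toDualTensor p).intertwiningMap_of_isIntertwiningMap _ _ (toDualTensor_equivariant hp)
  have hj : ∀ v, j v = toDualTensor p v := fun v => rfl
  have hφj : TensorProduct.dualDistrib ℂ (Module.Dual ℂ V₁) σ₃.toSubmodule (φ₁ ⊗ₜ[ℂ] φ₃) (j u₂) =
      φ₃ (p (u₁ ⊗ₜ u₂)) := by
    have := dualDistrib_apply_eq_dualTensorHom u₁ φ₃ (j u₂)
    rwa [LinearEquiv.apply_symm_apply, hj, dualTensorHom_toDualTensor] at this
  have hj0 : j ≠ 0 := fun h => hφw (by rw [← hφj, h]; exact map_zero _)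
  have hjinj : Function.Injective j.toLinearMap :=
    (Representation.IsIrreducible.injective_or_eq_zero j).resolve_right hj0
  let P : Subrepresentation (σ₁.dual.tprod σ₃.toRepresentation) := j.range
  let e : Representation.Equiv σ₂ P.toRepresentation :=
    Representation.Equiv.mk (LinearEquiv.ofInjective j.toLinearMap hjinj) fun g =>
      LinearMap.ext fun v => Subtype.ext
        (Representation.IntertwiningMap.isIntertwining _ _ j g v)
  have hPmu : @HasHighestWeight n P.toSubmodule _ _ P.toRepresentation mu :=
    @HasHighestWeight.of_equiv n V₂ _ _ P.toSubmodule _ _ σ₂ P.toRepresentation e mu h₂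
  have hw₀ : -(w₀ n).act lam + (w₀ n).act (lam + mu) = (w₀ n).act mu := by
    rw [WeylGroup.act_add]
    abel
  refine ⟨P, fun Q => ⟨?_, ?_⟩, ⟨e⟩, j u₂, ⟨u₂, rfl⟩, ?_⟩
  · rintro ⟨hQirr, lam', mu', hlam', hmu', kap, w, hkap, hext⟩
    rw [hlam'.unique (h₁.dual hc₁), hmu'.unique h₃, hw₀] at hext
    have hmukap : kap = mu := by
      -- From `w₀ μ = w κ` and `w₀² = 1` one gets `μ = (w₀ w) κ`; conjugate highest weights
      -- coincide.
      refine hkap.eq_of_act h₂ (w := w₀ n * w) ?_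
      rw [WeylGroup.act_mul, ← hext, ← WeylGroup.act_mul, w₀_mul_w₀, WeylGroup.act_one]
    rw [hmukap] at hkap
    have hcQ := (hc₁.dual.tprod hc₃).toRepresentation Q
    obtain ⟨f⟩ := nonempty_equiv_of_hasHighestWeight hc₂ hcQ hirr₂ hQirr h₂ hkap
    obtain ⟨q, hq, hjq⟩ := exists_eq_toDualTensor (σ₁ := σ₁) (σ₂ := σ₂) (τ := σ₃.toRepresentation)
      (j := Q.toSubmodule.subtype ∘ₗ f.toLinearMap) fun g v => congrArg Subtype.val
        (Representation.IntertwiningMap.isIntertwining _ _ f.toIntertwiningMap g v)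
    -- The embedding of `Q` is thus `c • j`, and `c ≠ 0` since `f` is injective, so `Q` and `P` are
    -- the same subspace.
    obtain ⟨c, rfl⟩ := exists_eq_smul_of_equivariant hc₁ hc₂ hc₃ hirr₁ hirr₂ hirr₃ h₁ h₂ h₃ hp hps hq
    have hfv : ∀ v, (f v : Module.Dual ℂ V₁ ⊗[ℂ] σ₃.toSubmodule) = c • j v := fun v => by
      have := LinearMap.congr_fun hjq v
      rwa [toDualTensor_smul] at this
    have hc0 : c ≠ 0 := by
      rintro rfl
      have h0 : f u₂ = 0 := Subtype.ext (by rw [hfv, zero_smul]; rfl)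
      apply hu₂0
      rw [← f.symm_apply_apply u₂, h0]
      exact map_zero f.symm.toLinearMap
    refine Subrepresentation.toSubmodule_injective (le_antisymm (fun x hx => ?_) ?_)
    · have h1 := hfv (f.symm ⟨x, hx⟩)
      rw [f.apply_symm_apply] at h1
      exact ⟨c • f.symm ⟨x, hx⟩, by rw [map_smul]; exact h1.symm⟩
    · rintro _ ⟨v, rfl⟩
      have h1 : j v = c⁻¹ • (f v : Module.Dual ℂ V₁ ⊗[ℂ] σ₃.toSubmodule) := by
        rw [hfv, smul_smul, inv_mul_cancel₀ hc0, one_smul]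
      change j v ∈ Q.toSubmodule
      rw [h1]
      exact Q.toSubmodule.smul_mem _ (f v).2
  · rintro rfl
    exact ⟨isIrreducible_of_equiv hirr₂ e, _, _, h₁.dual hc₁, h₃, mu, w₀ n, hPmu, hw₀⟩
  · rw [hφj]
    exact hφw
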